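/- An edge-to-edge gluing of $m$ unit squares matches the $4m$ sides of $m$ unit squares in pairs, each side with another side, and identifies the two sides of each pair by one of the two isometries between them; the glued surface carries the intrinsic (quotient) metric. The gluing corresponds to a convex polyhedron if its surface is isometric to the boundary of a convex polyhedron in $\mathbb{R}^3$ with its intrinsic metric, where doubly covered convex polygons (two copies of a convex polygon glued along the boundary) are also regarded as convex polyhedra. Two gluings are isomorphic if their surfaces are isometric. Theorem. There are $\Omega(n^3)$ pairwise non-isomorphic edge-to-edge gluings of at most $n$ unit squares that correspond to convex polyhedra: there are constants $c>0$ and $N$ such that for every $n\ge N$ there are at least $c\,n^3$ such gluings. Moreover, these gluings can be chosen so that the surface of each of them is isometric to a doubly covered octagon obtained from a rectangle $[0,a]\times[0,b]$ with $a,b\in\mathbb{N}$ by cutting off at each of the four corners a right isosceles triangle whose legs lie on the sides of the rectangle and have positive integer length, such that a segment of positive length remains of each side of the rectangle. -/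

import Mathlib

open scoped ENNReal

/-- The Euclidean plane. -/
abbrev Plane : Type := EuclideanSpace ℝ (Fin 2)

/-- Euclidean 3-space. -/
abbrev Space : Type := EuclideanSpace ℝ (Fin 3)

/-! ### Gluing metric pieces

`ι × X` is a disjoint union of copies of `X` indexed by `ι`, and `r` says which points are to be
glued.  Distances in the glued space are infima of lengths of chains, where one moves inside a
single piece at the cost of the distance there, and jumps between glued points for free. -/

/-- `GlueChain r x y c`: there is a chain of total length `c` from `x` to `y`. -/
inductive GlueChain {ι X : Type} [PseudoEMetricSpace X] (r : ι × X → ι × X → Prop) :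
    ι × X → ι × X → ℝ≥0∞ → Prop
  | refl (x : ι × X) : GlueChain r x x 0
  | move {x : ι × X} {i : ι} {p : X} {c : ℝ≥0∞} (q : X) (h : GlueChain r x (i, p) c) :
      GlueChain r x (i, q) (c + edist p q)
  | jump {x y z : ι × X} {c : ℝ≥0∞} (h : GlueChain r x y c) (hr : r y z ∨ r z y) :
      GlueChain r x z c

theorem GlueChain.append {ι X : Type} [PseudoEMetricSpace X] {r : ι × X → ι × X → Prop}
    {x y z : ι × X} {c d : ℝ≥0∞} (h₁ : GlueChain r x y c) (h₂ : GlueChain r y z d) :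
    GlueChain r x z (c + d) := by
  induction h₂ with
  | refl => simpa using h₁
  | move q _ ih => simpa [add_assoc] using GlueChain.move q ih
  | jump _ hr ih => exact GlueChain.jump ih hr

theorem GlueChain.symm {ι X : Type} [PseudoEMetricSpace X] {r : ι × X → ι × X → Prop}
    {x y : ι × X} {c : ℝ≥0∞} (h : GlueChain r x y c) : GlueChain r y x c := by
  induction h with
  | refl => exact GlueChain.refl _
  | @move i p c q _ ih =>
    have h₁ : GlueChain r (i, q) (i, p) (0 + edist q p) := GlueChain.move p (GlueChain.refl _)
    simpa [edist_comm, add_comm] using h₁.append ih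
  | @jump y z c _ hr ih =>
    have h₁ : GlueChain r z y 0 := GlueChain.jump (GlueChain.refl _) hr.symm
    simpa using h₁.append ih

/-- The disjoint union of the pieces, carrying the gluing pseudometric. -/
def GluedPieces {ι X : Type} (_r : ι × X → ι × X → Prop) : Type := ι × X

noncomputable instance instGluedPieces {ι X : Type} [PseudoEMetricSpace X] (r : ι × X → ι × X → Prop) :
    PseudoEMetricSpace (GluedPieces r) where
  edist x y := ⨅ (c : ℝ≥0∞) (_ : GlueChain r x y c), c
  edist_self x := le_antisymm (iInf₂_le 0 (GlueChain.refl x)) bot_le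
  edist_comm x y := le_antisymm
    (le_iInf₂ fun c h => iInf₂_le c h.symm) (le_iInf₂ fun c h => iInf₂_le c h.symm)
  edist_triangle x y z := by
    simp only [ENNReal.iInf_add, ENNReal.add_iInf]
    exact le_iInf₂ fun c h => le_iInf₂ fun d h' => iInf₂_le _ (h'.append h)

/-- The glued space: points at gluing distance zero are identified. -/
abbrev GluedSpace {ι X : Type} [PseudoEMetricSpace X] (r : ι × X → ι × X → Prop) : Type :=
  SeparationQuotient (GluedPieces r)

/-! ### Edge-to-edge gluings of unit squares -/

/-- The unit square `[0,1]²`. -/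
def unitSquare : Set Plane := {p | ∀ i, p i ∈ Set.Icc (0 : ℝ) 1}

/-- The four sides of the unit square, parametrized counterclockwise by `t ∈ [0,1]`. -/
noncomputable def sidePoint (k : Fin 4) (t : ℝ) : Plane :=
  match k with
  | 0 => !₂[t, 0]
  | 1 => !₂[1, t]
  | 2 => !₂[1 - t, 1]
  | 3 => !₂[0, 1 - t]

/-- An edge-to-edge gluing of `m` unit squares: the `4 * m` sides are matched in pairs, each side
with another one, and each matched pair is identified in one of the two isometric ways. -/
structure SquareGluing (m : ℕ) where
  partner : Fin m × Fin 4 → Fin m × Fin 4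
  partner_partner : ∀ s, partner (partner s) = s
  partner_ne : ∀ s, partner s ≠ s
  /-- `true` if the side is identified with its partner respecting the counterclockwise
  parametrizations, `false` if it is identified against them. -/
  flipped : Fin m × Fin 4 → Bool
  flipped_partner : ∀ s, flipped (partner s) = flipped s

/-- The points of the squares that are identified by the gluing. -/
def SquareGluing.Identifies {m : ℕ} (G : SquareGluing m) (x y : Fin m × unitSquare) : Prop :=
  ∃ k l : Fin 4, ∃ t ∈ Set.Icc (0 : ℝ) 1, G.partner (x.1, k) = (y.1, l) ∧
    (x.2 : Plane) = sidePoint k t ∧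
    (y.2 : Plane) = sidePoint l (if G.flipped (x.1, k) then t else 1 - t)

/-- The surface obtained from the squares by the gluing, with its intrinsic metric. -/
abbrev SquareGluing.Surface {m : ℕ} (G : SquareGluing m) : Type := GluedSpace G.Identifies

/-! ### Surfaces of convex polyhedra -/

/-- A nondegenerate convex polygon, as a closed region of the plane. -/
def IsConvexPolygon (P : Set Plane) : Prop :=
  (∃ s : Set Plane, s.Finite ∧ P = convexHull ℝ s) ∧ (interior P).Nonempty

/-- A nondegenerate convex polyhedron, as a solid body in space. -/
def IsConvexPolyhedron (K : Set Space) : Prop :=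
  (∃ s : Set Space, s.Finite ∧ K = convexHull ℝ s) ∧ (interior K).Nonempty

/-- The doubly covered region `P`: two copies of `P`, glued along the boundary. -/
abbrev DoublyCovered (P : Set Plane) : Type :=
  GluedSpace (fun x y : Bool × P => x.2 = y.2 ∧ (x.2 : Plane) ∈ frontier P)

/-- The intrinsic distance in `S ⊆ ℝ³`: the infimum of lengths of curves in `S`. -/
noncomputable def intrinsicEDist (S : Set Space) (p q : Space) : ℝ≥0∞ :=
  ⨅ (γ : ℝ → Space) (_ : ContinuousOn γ (Set.Icc 0 1) ∧ Set.MapsTo γ (Set.Icc 0 1) S ∧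
    γ 0 = p ∧ γ 1 = q), eVariationOn γ (Set.Icc 0 1)

/-- The gluing corresponds to a convex polyhedron: its surface is isometric to the boundary of a
convex polyhedron in space with the intrinsic metric, or to a doubly covered convex polygon. -/
def SquareGluing.CorrespondsToConvexPolyhedron {m : ℕ} (G : SquareGluing m) : Prop :=
  (∃ K : Set Space, IsConvexPolyhedron K ∧ ∃ f : G.Surface → Space,
    Set.range f = frontier K ∧ ∀ x y, edist x y = intrinsicEDist (frontier K) (f x) (f y)) ∨
  (∃ P : Set Plane, IsConvexPolygon P ∧ Nonempty (G.Surface ≃ᵢ DoublyCovered P))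

/-! ### Octagons cut from lattice rectangles -/

/-- An octagon obtained from the lattice rectangle `[0, width] × [0, height]` by cutting off at
each corner a right isosceles triangle with legs of positive integer length along the sides, so
that a part of positive length of each side of the rectangle remains. -/
structure LatticeOctagon where
  width : ℕ
  height : ℕ
  bottomLeft : ℕ
  bottomRight : ℕ
  topRight : ℕ
  topLeft : ℕ
  bottomLeft_pos : 0 < bottomLeft
  bottomRight_pos : 0 < bottomRight
  topRight_pos : 0 < topRight
  topLeft_pos : 0 < topLeft
  bottom_lt : bottomLeft + bottomRight < width
  top_lt : topLeft + topRight < width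
  left_lt : bottomLeft + topLeft < height
  right_lt : bottomRight + topRight < height

/-- The closed region of the plane bounded by the octagon. -/
def LatticeOctagon.region (O : LatticeOctagon) : Set Plane :=
  {p | 0 ≤ p 0 ∧ p 0 ≤ O.width ∧ 0 ≤ p 1 ∧ p 1 ≤ O.height ∧
    (O.bottomLeft : ℝ) ≤ p 0 + p 1 ∧
    (O.bottomRight : ℝ) ≤ (O.width - p 0) + p 1 ∧
    (O.topRight : ℝ) ≤ (O.width - p 0) + (O.height - p 1) ∧
    (O.topLeft : ℝ) ≤ p 0 + (O.height - p 1)}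

/-! The bound is a parameter count. An octagon of the stated kind has six integer parameters (two
sides of the rectangle, four cuts). If all of them are of order `k`, its area is of order `k ^ 2`,
so about `n` squares leave room for `k` of order `√n`, and there are `k ^ 6`, of order `n ^ 3`,
choices. Two facts turn this count into the theorem.

The double of each octagon is a gluing of squares (`nonempty_surface_isometryEquiv`). A lattice cell
inside the octagon gives two squares, one per sheet. A cell halved by a slanted edge gives a single
square, folded along that edge so that its two halves lie on the two sheets. The isometry is given
by a correspondence between points of squares and points of sheets that expands distances in neither
direction. From squares to sheets the only real case is a folded square, treated by reflection in
the cut (`edist_fold_le`). From sheets to squares, a straight segment is split by the finitely many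
cells it meets (`edist_le_of_corr`). The doubled octagon is itself a degenerate convex polyhedron,
so nothing has to be realized in space.

Few octagons have the same double (`card_le_of_isometricDoubles`). The vertices are visible in the
metric of the double: they are exactly the points not strictly between two others, because a path
through a vertex can be shortened on either side of a corner of angle less than `π`
(`exists_shortcut`), while any other point is the midpoint of a segment on its sheet. Hence an
isometry of doubles maps vertices to vertices and preserves their distances, and those labelled
distances determine the octagon. So at most `8 ^ 8` octagons share a double, and `k ^ 6 / 8 ^ 8`
classes remain. -/

/-! ### Glued pseudometrics and nonexpansive correspondences -/

section Gluing

variable {ι X : Type} [PseudoEMetricSpace X] {r : ι × X → ι × X → Prop}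

theorem GluedPieces.edist_le_of_chain {x y : GluedPieces r} {c : ℝ≥0∞}
    (h : GlueChain r x y c) : edist x y ≤ c :=
  iInf₂_le c h

theorem GluedPieces.edist_move (i : ι) (p q : X) :
    edist (show GluedPieces r from (i, p)) (show GluedPieces r from (i, q)) ≤ edist p q := by
  have h : GlueChain r (i, p) (i, q) (0 + edist p q) := GlueChain.move q (GlueChain.refl _)
  rw [zero_add] at h
  exact edist_le_of_chain h

theorem GluedPieces.edist_jump {x y : GluedPieces r} (h : r x y) : edist x y = 0 :=
  le_antisymm (edist_le_of_chain (GlueChain.jump (GlueChain.refl x) (Or.inl h))) bot_le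

/-- A correspondence out of a glued space that expands neither moves nor jumps is nonexpansive. -/
theorem GluedPieces.edist_le_of_rel {B : Type} [PseudoEMetricSpace B]
    (Rel : GluedPieces r → B → Prop) (total : ∀ x, ∃ b, Rel x b)
    (hmove : ∀ (i : ι) (p q : X) (b b' : B), Rel (i, p) b → Rel (i, q) b' →
      edist b b' ≤ edist p q)
    (hjump : ∀ (x y : ι × X) (b b' : B), r x y → Rel x b → Rel y b' → edist b b' = 0)
    {x y : GluedPieces r} {b b' : B} (hb : Rel x b) (hb' : Rel y b') :
    edist b b' ≤ edist x y := by
  refine le_iInf₂ fun c h => ?_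
  -- `Rel` may be multivalued; a move of length zero shows that all partners of one point are at
  -- distance zero.
  have hself : ∀ (x : ι × X) (b b' : B), Rel x b → Rel x b' → edist b b' = 0 := by
    rintro ⟨i, p⟩ b b' h h'
    exact le_antisymm ((hmove i p p b b' h h').trans_eq (edist_self p)) bot_le
  induction h generalizing b' with
  | refl => exact (hself _ _ _ hb hb').le
  | @move i p c q _ ih =>
    obtain ⟨d, hd⟩ := total (i, p)
    exact (edist_triangle b d b').trans (add_le_add (ih hd) (hmove i p q d b' hd hb'))
  | @jump y z c _ hr ih =>
    obtain ⟨d, hd⟩ := total y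
    have h0 : edist d b' = 0 := by
      rcases hr with hr | hr
      · exact hjump _ _ _ _ hr hd hb'
      · rw [edist_comm]; exact hjump _ _ _ _ hr hb' hd
    exact (edist_triangle b d b').trans (by rw [h0, add_zero]; exact ih hd)

end Gluing

/-- Points on sides have several partners on both sides, so the comparison is naturally a relation
and not a map. Preservation of distances makes all partners of a point inseparable, so any choice of
partners descends to the quotients, and right totality gives surjectivity. -/
theorem nonempty_isometryEquiv_of_rel {A B : Type} [PseudoEMetricSpace A] [PseudoEMetricSpace B]
    (Rel : A → B → Prop) (left_total : ∀ a, ∃ b, Rel a b) (right_total : ∀ b, ∃ a, Rel a b)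
    (h : ∀ a a' b b', Rel a b → Rel a' b' → edist b b' = edist a a') :
    Nonempty (SeparationQuotient A ≃ᵢ SeparationQuotient B) := by
  choose f hf using left_total
  have hiso : ∀ a a', edist (f a) (f a') = edist a a' := fun a a' => h _ _ _ _ (hf a) (hf a')
  let F : SeparationQuotient A → SeparationQuotient B :=
    SeparationQuotient.lift (fun a => SeparationQuotient.mk (f a)) (by
      intro a a' haa
      rw [SeparationQuotient.mk_eq_mk, EMetric.inseparable_iff, hiso]
      exact EMetric.inseparable_iff.1 haa)
  have hF : Isometry F := by
    intro x y
    obtain ⟨a, rfl⟩ := SeparationQuotient.surjective_mk x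
    obtain ⟨a', rfl⟩ := SeparationQuotient.surjective_mk y
    simp only [F, SeparationQuotient.lift_mk, SeparationQuotient.edist_mk, hiso]
  have hs : Function.Surjective F := by
    intro y
    obtain ⟨b, rfl⟩ := SeparationQuotient.surjective_mk y
    obtain ⟨a, ha⟩ := right_total b
    refine ⟨SeparationQuotient.mk a, ?_⟩
    simp only [F, SeparationQuotient.lift_mk]
    rw [SeparationQuotient.mk_eq_mk, EMetric.inseparable_iff, h _ _ _ _ (hf a) ha, edist_self]
  exact ⟨⟨Equiv.ofBijective F ⟨hF.injective, hs⟩, hF⟩⟩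

/-- A function on a real interval which is Lipschitz on each set of a finite closed cover does not
stretch the distance of the end points. -/
theorem edist_le_of_finite_closed_cover {M κ : Type*} [PseudoEMetricSpace M] (f : ℝ → M)
    (K : ℝ≥0∞) (C : κ → Set ℝ) (hC : ∀ k, IsClosed (C k))
    (hf : ∀ k, ∀ x ∈ C k, ∀ y ∈ C k, edist (f x) (f y) ≤ K * edist x y) (s : Finset κ) :
    ∀ a b : ℝ, a ≤ b → Set.Icc a b ⊆ ⋃ k ∈ s, C k → edist (f a) (f b) ≤ K * edist a b := by
  classical
  induction s using Finset.strongInduction with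
  | H s ih =>
    intro a b hab hcov
    obtain ⟨k, hk, hak⟩ : ∃ k ∈ s, a ∈ C k := by
      simpa using hcov (Set.left_mem_Icc.2 hab)
    -- Take the last point `c` of `[a, b]` in the set `C k` containing `a`. After `c` the set `C k`
    -- is never met again, so the other sets cover `(c, b]`, and being closed and finite in number
    -- they cover `[c, b]`.
    obtain ⟨c, ⟨hcC, hac, hcb⟩, hmax⟩ : ∃ c ∈ C k ∩ Set.Icc a b, ∀ x ∈ C k ∩ Set.Icc a b, x ≤ c :=
      (isCompact_Icc.inter_left (hC k)).exists_isGreatest ⟨a, hak, Set.left_mem_Icc.2 hab⟩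
    have h1 : edist (f a) (f c) ≤ K * edist a c := hf k a hak c hcC
    rcases hcb.eq_or_lt with rfl | hlt
    · exact h1
    have hsub : Set.Icc c b ⊆ ⋃ k' ∈ s.erase k, C k' := by
      rw [← closure_Ioc hlt.ne]
      refine closure_minimal ?_ ?_
      · intro x hx
        obtain ⟨k', hk', hxk'⟩ : ∃ k' ∈ s, x ∈ C k' := by
          simpa using hcov ⟨hac.trans hx.1.le, hx.2⟩
        have hne : k' ≠ k := by
          rintro rfl
          exact absurd (hmax x ⟨hxk', hac.trans hx.1.le, hx.2⟩) (not_le.2 hx.1)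
        simp only [Set.mem_iUnion]
        exact ⟨k', Finset.mem_erase.2 ⟨hne, hk'⟩, hxk'⟩
      · exact Set.Finite.isClosed_biUnion (s.erase k).finite_toSet fun k' _ => hC k'
    have h2 := ih (s.erase k) (Finset.erase_ssubset hk) c b hlt.le hsub
    have h3 : edist a c + edist c b = edist a b := by
      rw [edist_comm a c, edist_comm c b, edist_comm a b, edist_dist, edist_dist, edist_dist,
        ← ENNReal.ofReal_add dist_nonneg dist_nonneg, Real.dist_eq, Real.dist_eq, Real.dist_eq,
        abs_of_nonneg (sub_nonneg.2 hac), abs_of_nonneg (sub_nonneg.2 hlt.le),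
        abs_of_nonneg (sub_nonneg.2 hab)]
      congr 1; ring
    calc edist (f a) (f b) ≤ edist (f a) (f c) + edist (f c) (f b) := edist_triangle _ _ _
      _ ≤ K * edist a c + K * edist c b := add_le_add h1 h2
      _ = K * edist a b := by rw [← mul_add, h3]

theorem notMem_interior_of_forall_pos {E : Type*} [NormedAddCommGroup E] [NormedSpace ℝ E]
    {S : Set E} {p : E} (d : E) (h : ∀ ε : ℝ, 0 < ε → p + ε • d ∉ S) : p ∉ interior S := by
  intro hp
  have hcont : Filter.Tendsto (fun ε : ℝ => p + ε • d) (nhdsWithin 0 (Set.Ioi 0)) (nhds p) := by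
    have : Continuous fun ε : ℝ => p + ε • d := by fun_prop
    simpa using (this.tendsto 0).mono_left nhdsWithin_le_nhds
  have h1 : ∀ᶠ ε : ℝ in nhdsWithin 0 (Set.Ioi 0), p + ε • d ∈ S :=
    hcont.eventually (mem_interior_iff_mem_nhds.1 hp)
  obtain ⟨ε, hε, hpos⟩ := (h1.and self_mem_nhdsWithin).exists
  exact h ε hpos hε

/-! ### The octagon as a convex region: frontier and vertices -/

namespace LatticeOctagon

variable (O : LatticeOctagon)

theorem real_bounds : (1 : ℝ) ≤ O.bottomLeft ∧ (1 : ℝ) ≤ O.bottomRight ∧ (1 : ℝ) ≤ O.topRight ∧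
    (1 : ℝ) ≤ O.topLeft ∧ (O.bottomLeft + O.bottomRight + 1 : ℝ) ≤ O.width ∧
    (O.topLeft + O.topRight + 1 : ℝ) ≤ O.width ∧ (O.bottomLeft + O.topLeft + 1 : ℝ) ≤ O.height ∧
    (O.bottomRight + O.topRight + 1 : ℝ) ≤ O.height := by
  refine ⟨?_, ?_, ?_, ?_, ?_, ?_, ?_, ?_⟩
  · exact_mod_cast O.bottomLeft_pos
  · exact_mod_cast O.bottomRight_pos
  · exact_mod_cast O.topRight_pos
  · exact_mod_cast O.topLeft_pos
  · exact_mod_cast O.bottom_lt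
  · exact_mod_cast O.top_lt
  · exact_mod_cast O.left_lt
  · exact_mod_cast O.right_lt

theorem continuous_coord (k : Fin 2) : Continuous fun p : Plane => p k := by fun_prop

theorem isClosed_region : IsClosed O.region := by
  have h0 := continuous_coord 0
  have h1 := continuous_coord 1
  simp only [region, Set.ofPred_and]
  exact (isClosed_le continuous_const h0).inter <|
    (isClosed_le h0 continuous_const).inter <|
    (isClosed_le continuous_const h1).inter <|
    (isClosed_le h1 continuous_const).inter <|
    (isClosed_le continuous_const (h0.add h1)).inter <|
    (isClosed_le continuous_const ((continuous_const.sub h0).add h1)).inter <|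
    (isClosed_le continuous_const ((continuous_const.sub h0).add
      (continuous_const.sub h1))).inter <|
    (isClosed_le continuous_const (h0.add (continuous_const.sub h1)))

theorem convex_region : Convex ℝ O.region := by
  rintro p ⟨a1, a2, a3, a4, a5, a6, a7, a8⟩ q ⟨b1, b2, b3, b4, b5, b6, b7, b8⟩ s t hs ht hst
  obtain rfl : t = 1 - s := by linarith
  simp only [region, Set.mem_ofPred_eq, PiLp.add_apply, PiLp.smul_apply, smul_eq_mul]
  refine ⟨?_, ?_, ?_, ?_, ?_, ?_, ?_, ?_⟩
  · nlinarith [mul_le_mul_of_nonneg_left a1 hs, mul_le_mul_of_nonneg_left b1 ht]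
  · nlinarith [mul_le_mul_of_nonneg_left a2 hs, mul_le_mul_of_nonneg_left b2 ht]
  · nlinarith [mul_le_mul_of_nonneg_left a3 hs, mul_le_mul_of_nonneg_left b3 ht]
  · nlinarith [mul_le_mul_of_nonneg_left a4 hs, mul_le_mul_of_nonneg_left b4 ht]
  · nlinarith [mul_le_mul_of_nonneg_left a5 hs, mul_le_mul_of_nonneg_left b5 ht]
  · nlinarith [mul_le_mul_of_nonneg_left a6 hs, mul_le_mul_of_nonneg_left b6 ht]
  · nlinarith [mul_le_mul_of_nonneg_left a7 hs, mul_le_mul_of_nonneg_left b7 ht]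
  · nlinarith [mul_le_mul_of_nonneg_left a8 hs, mul_le_mul_of_nonneg_left b8 ht]

/-- The point lies on the line through one of the edges of the octagon. -/
def Tight (p : Plane) : Prop :=
  p 0 = 0 ∨ p 0 = O.width ∨ p 1 = 0 ∨ p 1 = O.height ∨ p 0 + p 1 = O.bottomLeft ∨
    (O.width - p 0) + p 1 = O.bottomRight ∨
    (O.width - p 0) + (O.height - p 1) = O.topRight ∨ p 0 + (O.height - p 1) = O.topLeft

variable {O}

theorem mem_interior_of_not_tight {p : Plane} (hp : p ∈ O.region) (h : ¬ O.Tight p) :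
    p ∈ interior O.region := by
  have h0 := continuous_coord 0
  have h1 := continuous_coord 1
  obtain ⟨a1, a2, a3, a4, a5, a6, a7, a8⟩ := hp
  unfold Tight at h
  push Not at h
  obtain ⟨b1, b2, b3, b4, b5, b6, b7, b8⟩ := h
  rw [mem_interior_iff_mem_nhds]
  have e1 := (isOpen_lt continuous_const h0).mem_nhds (lt_of_le_of_ne a1 b1.symm)
  have e2 := (isOpen_lt h0 continuous_const).mem_nhds (lt_of_le_of_ne a2 b2)
  have e3 := (isOpen_lt continuous_const h1).mem_nhds (lt_of_le_of_ne a3 b3.symm)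
  have e4 := (isOpen_lt h1 continuous_const).mem_nhds (lt_of_le_of_ne a4 b4)
  have e5 := (isOpen_lt continuous_const (h0.add h1)).mem_nhds (lt_of_le_of_ne a5 b5.symm)
  have e6 := (isOpen_lt continuous_const ((continuous_const.sub h0).add h1)).mem_nhds
    (lt_of_le_of_ne a6 b6.symm)
  have e7 := (isOpen_lt continuous_const ((continuous_const.sub h0).add
    (continuous_const.sub h1))).mem_nhds (lt_of_le_of_ne a7 b7.symm)
  have e8 := (isOpen_lt continuous_const (h0.add (continuous_const.sub h1))).mem_nhds
    (lt_of_le_of_ne a8 b8.symm)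
  filter_upwards [e1, e2, e3, e4, e5, e6, e7, e8] with q c1 c2 c3 c4 c5 c6 c7 c8
  exact ⟨le_of_lt c1, le_of_lt c2, le_of_lt c3, le_of_lt c4, le_of_lt c5, le_of_lt c6,
    le_of_lt c7, le_of_lt c8⟩

/-- An arbitrarily small shift outwards violates a tight inequality, whereas eight strict
inequalities persist in a neighbourhood. -/
theorem mem_frontier_iff {p : Plane} : p ∈ frontier O.region ↔ p ∈ O.region ∧ O.Tight p := by
  rw [frontier, O.isClosed_region.closure_eq, Set.mem_sdiff]
  refine and_congr_right fun hp => ⟨fun h => ?_, fun h => ?_⟩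
  · by_contra h'
    exact h (mem_interior_of_not_tight hp h')
  · rcases h with h | h | h | h | h | h | h | h
    · refine notMem_interior_of_forall_pos !₂[-1, 0] fun ε hε hq => ?_
      have := hq.1
      simp at this; linarith
    · refine notMem_interior_of_forall_pos !₂[1, 0] fun ε hε hq => ?_
      have := hq.2.1
      simp at this; linarith
    · refine notMem_interior_of_forall_pos !₂[0, -1] fun ε hε hq => ?_
      have := hq.2.2.1
      simp at this; linarith
    · refine notMem_interior_of_forall_pos !₂[0, 1] fun ε hε hq => ?_
      have := hq.2.2.2.1
      simp at this; linarith
    · refine notMem_interior_of_forall_pos !₂[-1, 0] fun ε hε hq => ?_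
      have := hq.2.2.2.2.1
      simp at this; linarith
    · refine notMem_interior_of_forall_pos !₂[1, 0] fun ε hε hq => ?_
      have := hq.2.2.2.2.2.1
      simp at this; linarith
    · refine notMem_interior_of_forall_pos !₂[1, 0] fun ε hε hq => ?_
      have := hq.2.2.2.2.2.2.1
      simp at this; linarith
    · refine notMem_interior_of_forall_pos !₂[-1, 0] fun ε hε hq => ?_
      have := hq.2.2.2.2.2.2.2
      simp at this; linarith

theorem exists_pos_le_le {a b : ℝ} (ha : 0 < a) (hb : 0 < b) : ∃ ε : ℝ, 0 < ε ∧ ε ≤ a ∧ ε ≤ b :=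
  ⟨min a b, lt_min ha hb, min_le_left a b, min_le_right a b⟩

variable (O) in
/-- The eight vertices of the octagon. -/
noncomputable def vertex : Fin 8 → Plane
  | 0 => !₂[(O.bottomLeft : ℝ), 0]
  | 1 => !₂[(O.width : ℝ) - O.bottomRight, 0]
  | 2 => !₂[(O.width : ℝ), O.bottomRight]
  | 3 => !₂[(O.width : ℝ), O.height - O.topRight]
  | 4 => !₂[(O.width : ℝ) - O.topRight, O.height]
  | 5 => !₂[(O.topLeft : ℝ), O.height]
  | 6 => !₂[(0 : ℝ), O.height - O.topLeft]
  | 7 => !₂[(0 : ℝ), O.bottomLeft]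

/-- A point of the octagon other than the vertices is the midpoint of a segment in it. -/
theorem exists_midpoint {p : Plane} (hp : p ∈ O.region) (hv : ∀ k, p ≠ O.vertex k) :
    ∃ d : Plane, d ≠ 0 ∧ p + d ∈ O.region ∧ p - d ∈ O.region := by
  obtain ⟨r1, r2, r3, r4, r5, r6, r7, r8⟩ := O.real_bounds
  have hp' := hp
  obtain ⟨a1, a2, a3, a4, a5, a6, a7, a8⟩ := hp
  have hv' : ∀ k, p 0 = O.vertex k 0 → p 1 ≠ O.vertex k 1 := by
    intro k h0 h1
    exact hv k (by ext l; fin_cases l <;> assumption)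
  have v0 := hv' 0
  have v1 := hv' 1
  have v2 := hv' 2
  have v3 := hv' 3
  have v4 := hv' 4
  have v5 := hv' 5
  have v6 := hv' 6
  have v7 := hv' 7
  clear hv hv'
  simp [vertex] at v0 v1 v2 v3 v4 v5 v6 v7
  have ne0 : ∀ {x y : ℝ}, x ≠ 0 → !₂[x, y] ≠ (0 : Plane) := fun hx h => hx (by
    simpa using congrArg (fun q : Plane => q 0) h)
  have ne1 : ∀ {x y : ℝ}, y ≠ 0 → !₂[x, y] ≠ (0 : Plane) := fun hx h => hx (by
    simpa using congrArg (fun q : Plane => q 1) h)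
  by_cases ht : O.Tight p
  -- On an edge, `d` is parallel to the edge and `ε` is bounded by the room towards each of its two
  -- ends; both bounds are positive since `p` is neither end.
  · rcases ht with ht | ht | ht | ht | ht | ht | ht | ht
    · obtain ⟨ε, hε, hA, hB⟩ : ∃ ε : ℝ, 0 < ε ∧ ε ≤ p 1 - O.bottomLeft ∧ ε ≤ O.height - O.topLeft - p 1 :=
        exists_pos_le_le
          (lt_of_le_of_ne (by linarith) fun h => v7 (by linarith) (by linarith))
          (lt_of_le_of_ne (by linarith) fun h => v6 (by linarith) (by linarith))
      refine ⟨!₂[0, ε], ne1 hε.ne', ?_, ?_⟩ <;>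
        simp only [region, Set.mem_ofPred_eq, PiLp.add_apply, PiLp.sub_apply, Matrix.cons_val_zero,
          Matrix.cons_val_one] <;>
        refine ⟨?_, ?_, ?_, ?_, ?_, ?_, ?_, ?_⟩ <;> linarith
    · obtain ⟨ε, hε, hA, hB⟩ : ∃ ε : ℝ, 0 < ε ∧ ε ≤ p 1 - O.bottomRight ∧ ε ≤ O.height - O.topRight - p 1 :=
        exists_pos_le_le
          (lt_of_le_of_ne (by linarith) fun h => v2 (by linarith) (by linarith))
          (lt_of_le_of_ne (by linarith) fun h => v3 (by linarith) (by linarith))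
      refine ⟨!₂[0, ε], ne1 hε.ne', ?_, ?_⟩ <;>
        simp only [region, Set.mem_ofPred_eq, PiLp.add_apply, PiLp.sub_apply, Matrix.cons_val_zero,
          Matrix.cons_val_one] <;>
        refine ⟨?_, ?_, ?_, ?_, ?_, ?_, ?_, ?_⟩ <;> linarith
    · obtain ⟨ε, hε, hA, hB⟩ : ∃ ε : ℝ, 0 < ε ∧ ε ≤ p 0 - O.bottomLeft ∧ ε ≤ O.width - O.bottomRight - p 0 :=
        exists_pos_le_le
          (lt_of_le_of_ne (by linarith) fun h => v0 (by linarith) (by linarith))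
          (lt_of_le_of_ne (by linarith) fun h => v1 (by linarith) (by linarith))
      refine ⟨!₂[ε, 0], ne0 hε.ne', ?_, ?_⟩ <;>
        simp only [region, Set.mem_ofPred_eq, PiLp.add_apply, PiLp.sub_apply, Matrix.cons_val_zero,
          Matrix.cons_val_one] <;>
        refine ⟨?_, ?_, ?_, ?_, ?_, ?_, ?_, ?_⟩ <;> linarith
    · obtain ⟨ε, hε, hA, hB⟩ : ∃ ε : ℝ, 0 < ε ∧ ε ≤ p 0 - O.topLeft ∧ ε ≤ O.width - O.topRight - p 0 :=
        exists_pos_le_le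
          (lt_of_le_of_ne (by linarith) fun h => v5 (by linarith) (by linarith))
          (lt_of_le_of_ne (by linarith) fun h => v4 (by linarith) (by linarith))
      refine ⟨!₂[ε, 0], ne0 hε.ne', ?_, ?_⟩ <;>
        simp only [region, Set.mem_ofPred_eq, PiLp.add_apply, PiLp.sub_apply, Matrix.cons_val_zero,
          Matrix.cons_val_one] <;>
        refine ⟨?_, ?_, ?_, ?_, ?_, ?_, ?_, ?_⟩ <;> linarith
    · obtain ⟨ε, hε, hA, hB⟩ : ∃ ε : ℝ, 0 < ε ∧ ε ≤ p 0 ∧ ε ≤ p 1 :=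
        exists_pos_le_le
          (lt_of_le_of_ne (by linarith) fun h => v7 (by linarith) (by linarith))
          (lt_of_le_of_ne (by linarith) fun h => v0 (by linarith) (by linarith))
      refine ⟨!₂[ε, -ε], ne0 hε.ne', ?_, ?_⟩ <;>
        simp only [region, Set.mem_ofPred_eq, PiLp.add_apply, PiLp.sub_apply, Matrix.cons_val_zero,
          Matrix.cons_val_one] <;>
        refine ⟨?_, ?_, ?_, ?_, ?_, ?_, ?_, ?_⟩ <;> linarith
    · obtain ⟨ε, hε, hA, hB⟩ : ∃ ε : ℝ, 0 < ε ∧ ε ≤ O.width - p 0 ∧ ε ≤ p 1 :=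
        exists_pos_le_le
          (lt_of_le_of_ne (by linarith) fun h => v2 (by linarith) (by linarith))
          (lt_of_le_of_ne (by linarith) fun h => v1 (by linarith) (by linarith))
      refine ⟨!₂[ε, ε], ne0 hε.ne', ?_, ?_⟩ <;>
        simp only [region, Set.mem_ofPred_eq, PiLp.add_apply, PiLp.sub_apply, Matrix.cons_val_zero,
          Matrix.cons_val_one] <;>
        refine ⟨?_, ?_, ?_, ?_, ?_, ?_, ?_, ?_⟩ <;> linarith
    · obtain ⟨ε, hε, hA, hB⟩ : ∃ ε : ℝ, 0 < ε ∧ ε ≤ O.width - p 0 ∧ ε ≤ O.height - p 1 :=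
        exists_pos_le_le
          (lt_of_le_of_ne (by linarith) fun h => v3 (by linarith) (by linarith))
          (lt_of_le_of_ne (by linarith) fun h => v4 (by linarith) (by linarith))
      refine ⟨!₂[ε, -ε], ne0 hε.ne', ?_, ?_⟩ <;>
        simp only [region, Set.mem_ofPred_eq, PiLp.add_apply, PiLp.sub_apply, Matrix.cons_val_zero,
          Matrix.cons_val_one] <;>
        refine ⟨?_, ?_, ?_, ?_, ?_, ?_, ?_, ?_⟩ <;> linarith
    · obtain ⟨ε, hε, hA, hB⟩ : ∃ ε : ℝ, 0 < ε ∧ ε ≤ p 0 ∧ ε ≤ O.height - p 1 :=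
        exists_pos_le_le
          (lt_of_le_of_ne (by linarith) fun h => v6 (by linarith) (by linarith))
          (lt_of_le_of_ne (by linarith) fun h => v5 (by linarith) (by linarith))
      refine ⟨!₂[ε, ε], ne0 hε.ne', ?_, ?_⟩ <;>
        simp only [region, Set.mem_ofPred_eq, PiLp.add_apply, PiLp.sub_apply, Matrix.cons_val_zero,
          Matrix.cons_val_one] <;>
        refine ⟨?_, ?_, ?_, ?_, ?_, ?_, ?_, ?_⟩ <;> linarith
  · have hn := mem_interior_iff_mem_nhds.1 (mem_interior_of_not_tight hp' ht)
    obtain ⟨δ, hδ, hball⟩ := Metric.mem_nhds_iff.1 hn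
    have hnorm : ‖(!₂[δ / 2, 0] : Plane)‖ < δ := by
      have : ‖(!₂[δ / 2, 0] : Plane)‖ = δ / 2 := by
        rw [EuclideanSpace.norm_eq]
        simpa [Fin.sum_univ_two] using Real.sqrt_sq (by linarith : 0 ≤ δ / 2)
      linarith
    exact ⟨!₂[δ / 2, 0], ne0 (by linarith), hball (by simpa using hnorm),
      hball (by simpa [dist_eq_norm] using hnorm)⟩

end LatticeOctagon

/-! ### Shortening a broken line at a corner -/

section Corner

variable {E : Type*} [NormedAddCommGroup E] [InnerProductSpace ℝ E]

open scoped RealInnerProductSpace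

/-- Second-order expansion of the norm with explicit error: expand the square and use `2xy ≤ x² +
y²` for the two norms, which avoids the square root. -/
theorem norm_sub_smul_le {a : E} (ha : a ≠ 0) (e : E) (ε : ℝ) :
    ‖a - ε • e‖ ≤ ‖a‖ - ε * (⟪e, a⟫ / ‖a‖) + ε ^ 2 * (‖e‖ ^ 2 / (2 * ‖a‖)) := by
  have hpos : 0 < ‖a‖ := norm_pos_iff.2 ha
  have h1 : ‖a - ε • e‖ ^ 2 = ‖a‖ ^ 2 - 2 * ε * ⟪e, a⟫ + ε ^ 2 * ‖e‖ ^ 2 := by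
    rw [norm_sub_sq_real, inner_smul_right, norm_smul, real_inner_comm, mul_pow, Real.norm_eq_abs,
      sq_abs]
    ring
  have h2 : 2 * ‖a‖ * ‖a - ε • e‖ ≤ 2 * ‖a‖ ^ 2 - 2 * ε * ⟪e, a⟫ + ε ^ 2 * ‖e‖ ^ 2 := by
    nlinarith [sq_nonneg (‖a‖ - ‖a - ε • e‖)]
  have h3 : ‖a‖ - ε * (⟪e, a⟫ / ‖a‖) + ε ^ 2 * (‖e‖ ^ 2 / (2 * ‖a‖)) =
      (2 * ‖a‖ ^ 2 - 2 * ε * ⟪e, a⟫ + ε ^ 2 * ‖e‖ ^ 2) / (2 * ‖a‖) := by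
    field_simp
  rw [h3, le_div_iff₀ (by positivity)]
  linarith

/-- The hypothesis says that the first variation of the length is negative in direction `e`; for
small `ε` it beats the quadratic error. -/
theorem exists_norm_add_norm_lt {a b e : E} (ha : a ≠ 0) (hb : b ≠ 0)
    (h : 0 < ⟪e, a⟫ / ‖a‖ + ⟪e, b⟫ / ‖b‖) :
    ∃ ε : ℝ, 0 < ε ∧ ε ≤ 1 ∧ ‖a - ε • e‖ + ‖b - ε • e‖ < ‖a‖ + ‖b‖ := by
  set K := ⟪e, a⟫ / ‖a‖ + ⟪e, b⟫ / ‖b‖ with hK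
  set C := ‖e‖ ^ 2 / (2 * ‖a‖) + ‖e‖ ^ 2 / (2 * ‖b‖) with hC
  have hC0 : 0 ≤ C := by positivity
  -- From `ε * (C + 1) ≤ K` follows `ε * C < K`; the `+ 1` also avoids division by zero.
  refine ⟨min 1 (K / (C + 1)), lt_min one_pos (by positivity), min_le_left _ _, ?_⟩
  set ε := min 1 (K / (C + 1)) with hε
  have hε0 : 0 < ε := lt_min one_pos (by positivity)
  have hεK : ε * (C + 1) ≤ K := by
    rw [← le_div_iff₀ (by positivity)]; exact min_le_right _ _
  have h1 := norm_sub_smul_le ha e ε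
  have h2 := norm_sub_smul_le hb e ε
  have h3 : ε ^ 2 * C < ε * K := by nlinarith
  have h4 : ε * K = ε * (⟪e, a⟫ / ‖a‖) + ε * (⟪e, b⟫ / ‖b‖) := by rw [hK]; ring
  have h5 : ε ^ 2 * C = ε ^ 2 * (‖e‖ ^ 2 / (2 * ‖a‖)) + ε ^ 2 * (‖e‖ ^ 2 / (2 * ‖b‖)) := by
    rw [hC]; ring
  linarith

/-- A broken line through the apex of an angle less than `π` can be shortened by moving the
breaking point along one of the sides of the angle. -/
theorem exists_shorter_of_corner {e₁ e₂ : E}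
    (hpt : ∀ s t : ℝ, 0 ≤ s → 0 ≤ t → s • e₁ + t • e₂ = 0 → s = 0 ∧ t = 0)
    {a b : E} (ha : a ≠ 0) (hb : b ≠ 0)
    (ha' : ∃ s t : ℝ, 0 ≤ s ∧ 0 ≤ t ∧ a = s • e₁ + t • e₂)
    (hb' : ∃ s t : ℝ, 0 ≤ s ∧ 0 ≤ t ∧ b = s • e₁ + t • e₂) :
    ∃ ε : ℝ, 0 < ε ∧ ε ≤ 1 ∧ ∃ e, (e = e₁ ∨ e = e₂) ∧ ‖a - ε • e‖ + ‖b - ε • e‖ < ‖a‖ + ‖b‖ := by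
  obtain ⟨s, t, hs, ht, has⟩ := ha'
  obtain ⟨s', t', hs', ht', hbs⟩ := hb'
  have hna : 0 < ‖a‖ := norm_pos_iff.2 ha
  have hnb : 0 < ‖b‖ := norm_pos_iff.2 hb
  by_cases h1 : 0 < ⟪e₁, a⟫ / ‖a‖ + ⟪e₁, b⟫ / ‖b‖
  · obtain ⟨ε, h, h', h''⟩ := exists_norm_add_norm_lt ha hb h1
    exact ⟨ε, h, h', e₁, Or.inl rfl, h''⟩
  by_cases h2 : 0 < ⟪e₂, a⟫ / ‖a‖ + ⟪e₂, b⟫ / ‖b‖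
  · obtain ⟨ε, h, h', h''⟩ := exists_norm_add_norm_lt ha hb h2
    exact ⟨ε, h, h', e₂, Or.inr rfl, h''⟩
  -- Otherwise the sum `u` of the unit vectors along `a` and `b` has nonpositive inner product with
  -- both `e₁` and `e₂`. As `u` lies in the cone they span, `⟪u, u⟫ ≤ 0` and `u = 0`. Pointedness of
  -- the cone then makes the coefficients of `a` vanish.
  exfalso
  set u : E := ‖a‖⁻¹ • a + ‖b‖⁻¹ • b with hu
  have hin : ∀ e : E, ⟪e, u⟫ = ⟪e, a⟫ / ‖a‖ + ⟪e, b⟫ / ‖b‖ := by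
    intro e
    rw [hu, inner_add_right, inner_smul_right, inner_smul_right]
    ring
  have hu' : u = (‖a‖⁻¹ * s + ‖b‖⁻¹ * s') • e₁ + (‖a‖⁻¹ * t + ‖b‖⁻¹ * t') • e₂ := by
    have hcomb : ∀ x y : ℝ, x • a + y • b = (x * s + y * s') • e₁ + (x * t + y * t') • e₂ := by
      intro x y
      rw [has, hbs]
      module
    exact hcomb _ _
  have huu : ⟪u, u⟫ ≤ 0 := by
    nth_rw 1 [hu']
    rw [inner_add_left, inner_smul_left, inner_smul_left, hin e₁, hin e₂]
    have hS : 0 ≤ ‖a‖⁻¹ * s + ‖b‖⁻¹ * s' := by positivity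
    have hT : 0 ≤ ‖a‖⁻¹ * t + ‖b‖⁻¹ * t' := by positivity
    simp only [conj_trivial]
    nlinarith [mul_nonneg hS (neg_nonneg.2 (not_lt.1 h1)),
      mul_nonneg hT (neg_nonneg.2 (not_lt.1 h2))]
  have hu0 : u = 0 := inner_self_eq_zero.1 (le_antisymm huu real_inner_self_nonneg)
  rw [hu0] at hu'
  obtain ⟨hS, hT⟩ := hpt _ _ (by positivity) (by positivity) hu'.symm
  have hs0 : s = 0 := by
    have h3 : 0 ≤ ‖a‖⁻¹ * s := by positivity
    have h4 : 0 ≤ ‖b‖⁻¹ * s' := by positivity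
    have h5 : ‖a‖⁻¹ * s = 0 := by linarith
    simpa [hna.ne'] using h5
  have ht0 : t = 0 := by
    have h3 : 0 ≤ ‖a‖⁻¹ * t := by positivity
    have h4 : 0 ≤ ‖b‖⁻¹ * t' := by positivity
    have h5 : ‖a‖⁻¹ * t = 0 := by linarith
    simpa [hna.ne'] using h5
  exact ha (by rw [has, hs0, ht0]; simp)

end Corner

/-! ### The octagon as a polygon and its corners -/

namespace LatticeOctagon

variable {O : LatticeOctagon}

theorem isCompact_region : IsCompact O.region := by
  refine Metric.isCompact_of_isClosed_isBounded O.isClosed_region ?_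
  refine (Metric.isBounded_closedBall (x := (0 : Plane)) (r := O.width + O.height)).subset ?_
  rintro p ⟨a1, a2, a3, a4, -⟩
  rw [mem_closedBall_zero_iff, EuclideanSpace.norm_eq]
  refine Real.sqrt_le_iff.2 ⟨by linarith, ?_⟩
  simp only [Fin.sum_univ_two, Real.norm_eq_abs, sq_abs]
  nlinarith

theorem extremePoints_region_subset : O.region.extremePoints ℝ ⊆ Set.range O.vertex := by
  intro p hp
  by_contra h
  obtain ⟨d, hd, h1, h2⟩ := exists_midpoint hp.1 fun k hk => h ⟨k, hk.symm⟩
  refine hd (add_eq_left.1 (hp.2 h1 h2 ⟨1 / 2, 1 / 2, by norm_num, by norm_num, by norm_num, ?_⟩))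
  module

/-- Krein–Milman: the region is the closed hull of its extreme points, which are among the eight
vertices, and the hull of a finite set is already closed. -/
theorem isConvexPolygon_region : IsConvexPolygon O.region := by
  have hfin : (O.region.extremePoints ℝ).Finite :=
    (Set.finite_range O.vertex).subset extremePoints_region_subset
  refine ⟨⟨O.region.extremePoints ℝ, hfin, ?_⟩, !₂[(O.width : ℝ) / 2, O.height / 2], ?_⟩
  · rw [← (hfin.isClosed_convexHull ℝ).closure_eq]
    exact (closure_convexHull_extremePoints isCompact_region O.convex_region).symm
  · obtain ⟨r1, r2, r3, r4, r5, r6, r7, r8⟩ := O.real_bounds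
    refine mem_interior_of_not_tight ?_ ?_
    · simp only [region, Set.mem_ofPred_eq, Matrix.cons_val_zero, Matrix.cons_val_one]
      refine ⟨?_, ?_, ?_, ?_, ?_, ?_, ?_, ?_⟩ <;> linarith
    · simp only [Tight, Matrix.cons_val_zero, Matrix.cons_val_one]
      rintro (h | h | h | h | h | h | h | h) <;> linarith

/-- At each vertex, the octagon lies in the angle spanned by the directions of two edges. -/
theorem exists_edge_directions (k : Fin 8) : ∃ e₁ e₂ : Plane,
    (∀ s t : ℝ, 0 ≤ s → 0 ≤ t → s • e₁ + t • e₂ = 0 → s = 0 ∧ t = 0) ∧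
    (∀ p ∈ O.region, ∃ s t : ℝ, 0 ≤ s ∧ 0 ≤ t ∧ p - O.vertex k = s • e₁ + t • e₂) ∧
    ∀ ε : ℝ, 0 < ε → ε ≤ 1 → O.vertex k + ε • e₁ ∈ frontier O.region ∧
      O.vertex k + ε • e₂ ∈ frontier O.region := by
  -- Integrality makes every edge at least as long as the chosen direction vector, which allows all
  -- `ε ≤ 1`. In each case the cone coefficients of `p` are the slacks of the two edge inequalities
  -- meeting at the vertex.
  obtain ⟨r1, r2, r3, r4, r5, r6, r7, r8⟩ := O.real_bounds
  have aux : ∀ {x y z w : ℝ} {s t : ℝ}, s • (!₂[x, y] : Plane) + t • !₂[z, w] = 0 →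
      s * x + t * z = 0 ∧ s * y + t * w = 0 := fun h =>
    ⟨by simpa using congrArg (fun q : Plane => q 0) h,
      by simpa using congrArg (fun q : Plane => q 1) h⟩
  match k with
  | 0 =>
    refine ⟨!₂[1, 0], !₂[-1, 1], fun s t hs ht h => ?_, ?_, ?_⟩
    · obtain ⟨h1, h2⟩ := aux h
      constructor <;> linarith
    · rintro p ⟨a1, a2, a3, a4, a5, a6, a7, a8⟩
      refine ⟨p 0 - O.bottomLeft + p 1, p 1, by linarith, by linarith, ?_⟩
      ext l; fin_cases l <;> simp [vertex]
    · intro ε h0 h1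
      rw [mem_frontier_iff, mem_frontier_iff]
      simp only [region, Tight, vertex, Set.mem_ofPred_eq, PiLp.add_apply, PiLp.smul_apply,
        Matrix.cons_val_zero, Matrix.cons_val_one, smul_eq_mul]
      refine ⟨⟨⟨?_, ?_, ?_, ?_, ?_, ?_, ?_, ?_⟩, (Or.inr (Or.inr (Or.inl ?_)))⟩,
        ⟨?_, ?_, ?_, ?_, ?_, ?_, ?_, ?_⟩, (Or.inr (Or.inr (Or.inr (Or.inr (Or.inl ?_)))))⟩ <;> linarith
  | 1 =>
    refine ⟨!₂[-1, 0], !₂[1, 1], fun s t hs ht h => ?_, ?_, ?_⟩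
    · obtain ⟨h1, h2⟩ := aux h
      constructor <;> linarith
    · rintro p ⟨a1, a2, a3, a4, a5, a6, a7, a8⟩
      refine ⟨O.width - O.bottomRight - p 0 + p 1, p 1, by linarith, by linarith, ?_⟩
      ext l; fin_cases l <;> simp [vertex]
    · intro ε h0 h1
      rw [mem_frontier_iff, mem_frontier_iff]
      simp only [region, Tight, vertex, Set.mem_ofPred_eq, PiLp.add_apply, PiLp.smul_apply,
        Matrix.cons_val_zero, Matrix.cons_val_one, smul_eq_mul]
      refine ⟨⟨⟨?_, ?_, ?_, ?_, ?_, ?_, ?_, ?_⟩, (Or.inr (Or.inr (Or.inl ?_)))⟩,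
        ⟨?_, ?_, ?_, ?_, ?_, ?_, ?_, ?_⟩, (Or.inr (Or.inr (Or.inr (Or.inr (Or.inr (Or.inl ?_))))))⟩ <;> linarith
  | 2 =>
    refine ⟨!₂[0, 1], !₂[-1, -1], fun s t hs ht h => ?_, ?_, ?_⟩
    · obtain ⟨h1, h2⟩ := aux h
      constructor <;> linarith
    · rintro p ⟨a1, a2, a3, a4, a5, a6, a7, a8⟩
      refine ⟨p 1 - O.bottomRight + (O.width - p 0), O.width - p 0, by linarith, by linarith, ?_⟩
      ext l; fin_cases l <;> simp [vertex]
      ring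
    · intro ε h0 h1
      rw [mem_frontier_iff, mem_frontier_iff]
      simp only [region, Tight, vertex, Set.mem_ofPred_eq, PiLp.add_apply, PiLp.smul_apply,
        Matrix.cons_val_zero, Matrix.cons_val_one, smul_eq_mul]
      refine ⟨⟨⟨?_, ?_, ?_, ?_, ?_, ?_, ?_, ?_⟩, (Or.inr (Or.inl ?_))⟩,
        ⟨?_, ?_, ?_, ?_, ?_, ?_, ?_, ?_⟩, (Or.inr (Or.inr (Or.inr (Or.inr (Or.inr (Or.inl ?_))))))⟩ <;> linarith
  | 3 =>
    refine ⟨!₂[0, -1], !₂[-1, 1], fun s t hs ht h => ?_, ?_, ?_⟩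
    · obtain ⟨h1, h2⟩ := aux h
      constructor <;> linarith
    · rintro p ⟨a1, a2, a3, a4, a5, a6, a7, a8⟩
      refine ⟨O.height - O.topRight - p 1 + (O.width - p 0), O.width - p 0, by linarith, by linarith, ?_⟩
      ext l; fin_cases l <;> simp [vertex]
      ring
    · intro ε h0 h1
      rw [mem_frontier_iff, mem_frontier_iff]
      simp only [region, Tight, vertex, Set.mem_ofPred_eq, PiLp.add_apply, PiLp.smul_apply,
        Matrix.cons_val_zero, Matrix.cons_val_one, smul_eq_mul]
      refine ⟨⟨⟨?_, ?_, ?_, ?_, ?_, ?_, ?_, ?_⟩, (Or.inr (Or.inl ?_))⟩,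
        ⟨?_, ?_, ?_, ?_, ?_, ?_, ?_, ?_⟩, (Or.inr (Or.inr (Or.inr (Or.inr (Or.inr (Or.inr (Or.inl ?_)))))))⟩ <;> linarith
  | 4 =>
    refine ⟨!₂[-1, 0], !₂[1, -1], fun s t hs ht h => ?_, ?_, ?_⟩
    · obtain ⟨h1, h2⟩ := aux h
      constructor <;> linarith
    · rintro p ⟨a1, a2, a3, a4, a5, a6, a7, a8⟩
      refine ⟨O.width - O.topRight - p 0 + (O.height - p 1), O.height - p 1, by linarith, by linarith, ?_⟩
      ext l; fin_cases l <;> simp [vertex]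
      ring
    · intro ε h0 h1
      rw [mem_frontier_iff, mem_frontier_iff]
      simp only [region, Tight, vertex, Set.mem_ofPred_eq, PiLp.add_apply, PiLp.smul_apply,
        Matrix.cons_val_zero, Matrix.cons_val_one, smul_eq_mul]
      refine ⟨⟨⟨?_, ?_, ?_, ?_, ?_, ?_, ?_, ?_⟩, (Or.inr (Or.inr (Or.inr (Or.inl ?_))))⟩,
        ⟨?_, ?_, ?_, ?_, ?_, ?_, ?_, ?_⟩, (Or.inr (Or.inr (Or.inr (Or.inr (Or.inr (Or.inr (Or.inl ?_)))))))⟩ <;> linarith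
  | 5 =>
    refine ⟨!₂[1, 0], !₂[-1, -1], fun s t hs ht h => ?_, ?_, ?_⟩
    · obtain ⟨h1, h2⟩ := aux h
      constructor <;> linarith
    · rintro p ⟨a1, a2, a3, a4, a5, a6, a7, a8⟩
      refine ⟨p 0 - O.topLeft + (O.height - p 1), O.height - p 1, by linarith, by linarith, ?_⟩
      ext l; fin_cases l <;> simp [vertex]
      ring
    · intro ε h0 h1
      rw [mem_frontier_iff, mem_frontier_iff]
      simp only [region, Tight, vertex, Set.mem_ofPred_eq, PiLp.add_apply, PiLp.smul_apply,
        Matrix.cons_val_zero, Matrix.cons_val_one, smul_eq_mul]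
      refine ⟨⟨⟨?_, ?_, ?_, ?_, ?_, ?_, ?_, ?_⟩, (Or.inr (Or.inr (Or.inr (Or.inl ?_))))⟩,
        ⟨?_, ?_, ?_, ?_, ?_, ?_, ?_, ?_⟩, (Or.inr (Or.inr (Or.inr (Or.inr (Or.inr (Or.inr (Or.inr ?_)))))))⟩ <;> linarith
  | 6 =>
    refine ⟨!₂[0, -1], !₂[1, 1], fun s t hs ht h => ?_, ?_, ?_⟩
    · obtain ⟨h1, h2⟩ := aux h
      constructor <;> linarith
    · rintro p ⟨a1, a2, a3, a4, a5, a6, a7, a8⟩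
      refine ⟨O.height - O.topLeft - p 1 + p 0, p 0, by linarith, by linarith, ?_⟩
      ext l; fin_cases l <;> simp [vertex]
    · intro ε h0 h1
      rw [mem_frontier_iff, mem_frontier_iff]
      simp only [region, Tight, vertex, Set.mem_ofPred_eq, PiLp.add_apply, PiLp.smul_apply,
        Matrix.cons_val_zero, Matrix.cons_val_one, smul_eq_mul]
      refine ⟨⟨⟨?_, ?_, ?_, ?_, ?_, ?_, ?_, ?_⟩, (Or.inl ?_)⟩,
        ⟨?_, ?_, ?_, ?_, ?_, ?_, ?_, ?_⟩, (Or.inr (Or.inr (Or.inr (Or.inr (Or.inr (Or.inr (Or.inr ?_)))))))⟩ <;> linarith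
  | 7 =>
    refine ⟨!₂[0, 1], !₂[1, -1], fun s t hs ht h => ?_, ?_, ?_⟩
    · obtain ⟨h1, h2⟩ := aux h
      constructor <;> linarith
    · rintro p ⟨a1, a2, a3, a4, a5, a6, a7, a8⟩
      refine ⟨p 1 - O.bottomLeft + p 0, p 0, by linarith, by linarith, ?_⟩
      ext l; fin_cases l <;> simp [vertex]
    · intro ε h0 h1
      rw [mem_frontier_iff, mem_frontier_iff]
      simp only [region, Tight, vertex, Set.mem_ofPred_eq, PiLp.add_apply, PiLp.smul_apply,
        Matrix.cons_val_zero, Matrix.cons_val_one, smul_eq_mul]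
      refine ⟨⟨⟨?_, ?_, ?_, ?_, ?_, ?_, ?_, ?_⟩, (Or.inl ?_)⟩,
        ⟨?_, ?_, ?_, ?_, ?_, ?_, ?_, ?_⟩, (Or.inr (Or.inr (Or.inr (Or.inr (Or.inl ?_)))))⟩ <;> linarith

/-- The new breaking point is moved along an edge, hence stays on the frontier. This makes the
shortcut available in the double whichever sheets `p` and `q` lie on. -/
theorem exists_shortcut (k : Fin 8) {p q : Plane} (hp : p ∈ O.region) (hq : q ∈ O.region)
    (hpv : p ≠ O.vertex k) (hqv : q ≠ O.vertex k) :
    ∃ m ∈ frontier O.region, dist p m + dist m q < dist p (O.vertex k) + dist (O.vertex k) q := by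
  obtain ⟨e₁, e₂, hpt, hcone, hedge⟩ := exists_edge_directions (O := O) k
  obtain ⟨ε, h0, h1, e, he, hlt⟩ := exists_shorter_of_corner hpt (sub_ne_zero.2 hpv)
    (sub_ne_zero.2 hqv) (hcone p hp) (hcone q hq)
  refine ⟨O.vertex k + ε • e, ?_, ?_⟩
  · rcases he with rfl | rfl
    · exact (hedge ε h0 h1).1
    · exact (hedge ε h0 h1).2
  · rw [dist_comm (O.vertex k + _) q, dist_comm (O.vertex k) q]
    simp only [dist_eq_norm]
    rwa [← sub_sub, ← sub_sub]

end LatticeOctagon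

/-! ### Combinatorics of the square gluing -/

namespace LatticeOctagon

variable (O : LatticeOctagon)

/-- The lattice cell `[i, i+1] × [j, j+1]` meets the interior of the octagon. -/
def IsCell (i j : ℤ) : Prop :=
  0 ≤ i ∧ i < O.width ∧ 0 ≤ j ∧ j < O.height ∧
    (O.bottomLeft : ℤ) ≤ i + j + 1 ∧ (O.bottomRight : ℤ) ≤ O.width - i + j ∧
    (O.topRight : ℤ) ≤ O.width + O.height - i - j - 1 ∧ (O.topLeft : ℤ) ≤ i + O.height - j

/-- The cell is halved by an edge of slope `-1` of the octagon. -/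
def AntiCut (i j : ℤ) : Prop :=
  i + j + 1 = O.bottomLeft ∨ O.width + O.height - i - j - 1 = O.topRight

/-- The cell is halved by an edge of slope `1` of the octagon. -/
def MainCut (i j : ℤ) : Prop :=
  O.width - i + j = O.bottomRight ∨ i + O.height - j = O.topLeft

/-- The cell is not halved by an edge of the octagon. -/
def Uncut (i j : ℤ) : Prop := ¬ O.AntiCut i j ∧ ¬ O.MainCut i j

/-- The side `l` of the cell lies in the octagon. -/
def Inner (i j : ℤ) (l : Fin 4) : Prop :=
  (i + j + 1 = O.bottomLeft → l = 1 ∨ l = 2) ∧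
  (O.width - i + j = O.bottomRight → l = 2 ∨ l = 3) ∧
  (O.width + O.height - i - j - 1 = O.topRight → l = 3 ∨ l = 0) ∧
  (i + O.height - j = O.topLeft → l = 0 ∨ l = 1)

instance (i j : ℤ) : Decidable (O.IsCell i j) := by unfold IsCell; infer_instance
instance (i j : ℤ) : Decidable (O.AntiCut i j) := by unfold AntiCut; infer_instance
instance (i j : ℤ) : Decidable (O.MainCut i j) := by unfold MainCut; infer_instance
instance (i j : ℤ) : Decidable (O.Uncut i j) := by unfold Uncut; infer_instance
instance (i j : ℤ) (l : Fin 4) : Decidable (O.Inner i j l) := by unfold Inner; infer_instance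

/-- Reflection of the sides of a cell in the edge of the octagon that halves it, and in the main
diagonal if there is no such edge. -/
def mirrorSide (i j : ℤ) (l : Fin 4) : Fin 4 := if O.AntiCut i j then 1 - l else 3 - l

theorem mirrorSide_mirrorSide (i j : ℤ) (l : Fin 4) :
    O.mirrorSide i j (O.mirrorSide i j l) = l := by
  unfold mirrorSide; split_ifs <;> exact sub_sub_cancel _ _

/-- The cell on the other side of the side `l`. -/
def across (i j : ℤ) (l : Fin 4) : ℤ × ℤ :=
  match l with
  | 0 => (i, j - 1)
  | 1 => (i + 1, j)
  | 2 => (i, j + 1)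
  | 3 => (i - 1, j)

theorem across_across (i j : ℤ) (l : Fin 4) :
    across (across i j l).1 (across i j l).2 (l + 2) = (i, j) := by
  fin_cases l <;> simp [across]

variable {O}

theorem Uncut.inner {i j : ℤ} (h : O.Uncut i j) (l : Fin 4) : O.Inner i j l := by
  unfold Uncut AntiCut MainCut at h
  unfold Inner
  refine ⟨?_, ?_, ?_, ?_⟩ <;> intro h' <;> omega

/-- Two adjacent sides of a halved cell lie in the octagon, and reflection in the cut exchanges them
with the other two. -/
theorem inner_mirrorSide_iff {i j : ℤ} (hc : O.IsCell i j) (h : ¬ O.Uncut i j) (l : Fin 4) :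
    O.Inner i j (O.mirrorSide i j l) ↔ ¬ O.Inner i j l := by
  have h1 := O.bottom_lt
  have h2 := O.top_lt
  have h3 := O.left_lt
  have h4 := O.right_lt
  unfold Uncut AntiCut MainCut at h
  unfold Inner mirrorSide AntiCut
  unfold IsCell at hc
  have h : i + j + 1 = O.bottomLeft ∨ O.width - i + j = O.bottomRight ∨
      O.width + O.height - i - j - 1 = O.topRight ∨ i + O.height - j = O.topLeft := by omega
  -- Since part of each side of the rectangle remains, a cell is halved by only one edge; the other
  -- three equations are refuted in each case.
  rcases h with h | h | h | h
  · have hb : ¬ O.width - i + j = (O.bottomRight : ℤ) := by omega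
    have hc : ¬ O.width + O.height - i - j - 1 = (O.topRight : ℤ) := by omega
    have hd : ¬ i + O.height - j = (O.topLeft : ℤ) := by omega
    simp only [h, hb, hc, hd, true_or, if_true, false_implies, true_implies, and_true]
    revert l; decide
  · have ha : ¬ i + j + 1 = (O.bottomLeft : ℤ) := by omega
    have hc : ¬ O.width + O.height - i - j - 1 = (O.topRight : ℤ) := by omega
    have hd : ¬ i + O.height - j = (O.topLeft : ℤ) := by omega
    simp only [h, ha, hc, hd, or_self, if_false, false_implies, true_implies, and_true, true_and]
    revert l; decide
  · have ha : ¬ i + j + 1 = (O.bottomLeft : ℤ) := by omega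
    have hb : ¬ O.width - i + j = (O.bottomRight : ℤ) := by omega
    have hd : ¬ i + O.height - j = (O.topLeft : ℤ) := by omega
    simp only [h, ha, hb, hd, or_true, if_true, false_implies, true_implies, and_true, true_and]
    revert l; decide
  · have ha : ¬ i + j + 1 = (O.bottomLeft : ℤ) := by omega
    have hb : ¬ O.width - i + j = (O.bottomRight : ℤ) := by omega
    have hc : ¬ O.width + O.height - i - j - 1 = (O.topRight : ℤ) := by omega
    simp only [h, ha, hb, hc, or_self, if_false, false_implies, true_implies, true_and]
    revert l; decide

theorem inner_across {i j : ℤ} {l : Fin 4} (hc : O.IsCell i j) (hl : O.Inner i j l)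
    (hc' : O.IsCell (across i j l).1 (across i j l).2) :
    O.Inner (across i j l).1 (across i j l).2 (l + 2) := by
  unfold Inner at hl ⊢
  unfold IsCell at hc hc'
  fin_cases l <;> simp [across] at hl hc' ⊢ <;> omega

variable (O)

/-- The squares of the gluing: two for each cell inside the octagon, one for each halved cell. -/
abbrev Square : Type :=
  {q : Bool × ℤ × ℤ // O.IsCell q.2.1 q.2.2 ∧ (q.1 = true → O.Uncut q.2.1 q.2.2)}

/-- The sides of cells on the two sheets of the doubly covered octagon. -/
abbrev Flag : Type :=
  {f : Bool × ℤ × ℤ × Fin 4 // O.IsCell f.2.1 f.2.2.1 ∧ O.Inner f.2.1 f.2.2.1 f.2.2.2}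

/-- The sheet on which the side of a square lies. -/
def sheet (s : Bool) (i j : ℤ) (l : Fin 4) : Bool :=
  if O.Uncut i j then s else !decide (O.Inner i j l)

/-- Reflection of the sides of a cell on the upper sheet only. -/
def mirrorIf (s : Bool) (i j : ℤ) (l : Fin 4) : Fin 4 := if s then O.mirrorSide i j l else l

/-- The sides of squares correspond to the sides of cells on the two sheets. -/
def sideEquiv : O.Square × Fin 4 ≃ O.Flag where
  -- An uncut square lies on its own sheet. A halved square is folded: its inner sides stay on the
  -- lower sheet, its outer sides appear, reflected, on the upper one.
  toFun x := ⟨(O.sheet x.1.1.1 x.1.1.2.1 x.1.1.2.2 x.2, x.1.1.2.1, x.1.1.2.2,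
      O.mirrorIf (O.sheet x.1.1.1 x.1.1.2.1 x.1.1.2.2 x.2) x.1.1.2.1 x.1.1.2.2 x.2), by
    obtain ⟨⟨⟨s, i, j⟩, hc, hs⟩, l⟩ := x
    refine ⟨hc, ?_⟩
    simp only at hc hs ⊢
    by_cases hu : O.Uncut i j
    · exact hu.inner _
    · by_cases hl : O.Inner i j l
      · simp [sheet, mirrorIf, hu, hl]
      · simpa [sheet, mirrorIf, hu, hl] using (inner_mirrorSide_iff hc hu l).2 hl⟩
  -- The only square of a halved cell carries the label `false`, for both sheets.
  invFun f := (⟨(f.1.1 && decide (O.Uncut f.1.2.1 f.1.2.2.1), f.1.2.1, f.1.2.2.1), f.2.1, by simp⟩,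
    O.mirrorIf f.1.1 f.1.2.1 f.1.2.2.1 f.1.2.2.2)
  left_inv := by
    rintro ⟨⟨⟨s, i, j⟩, hc, hs⟩, l⟩
    simp only at hc hs
    by_cases hu : O.Uncut i j
    · cases s <;> simp [sheet, mirrorIf, hu, mirrorSide_mirrorSide]
    · have : s = false := by cases s <;> simp_all
      subst this
      by_cases hl : O.Inner i j l
      · simp [sheet, mirrorIf, hu, hl]
      · simp [sheet, mirrorIf, hu, hl, mirrorSide_mirrorSide]
  right_inv := by
    rintro ⟨⟨s, i, j, l⟩, hc, hl⟩
    simp only at hc hl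
    by_cases hu : O.Uncut i j
    · cases s <;> simp [sheet, mirrorIf, hu, mirrorSide_mirrorSide]
    · cases s
      · simp [sheet, mirrorIf, hu, hl]
      · have := (inner_mirrorSide_iff hc hu l).not_left.2 hl
        simp [sheet, mirrorIf, hu, this, mirrorSide_mirrorSide]

/-- Crossing a side of a cell: to the adjacent cell if there is one, and to the same cell on the
other sheet otherwise. -/
def cross (f : O.Flag) : O.Flag :=
  if h : O.IsCell (across f.1.2.1 f.1.2.2.1 f.1.2.2.2).1 (across f.1.2.1 f.1.2.2.1 f.1.2.2.2).2 then
    ⟨(f.1.1, (across f.1.2.1 f.1.2.2.1 f.1.2.2.2).1, (across f.1.2.1 f.1.2.2.1 f.1.2.2.2).2,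
      f.1.2.2.2 + 2), h, inner_across f.2.1 f.2.2 h⟩
  else ⟨(!f.1.1, f.1.2), f.2⟩

theorem cross_cross (f : O.Flag) : O.cross (O.cross f) = f := by
  obtain ⟨⟨s, i, j, l⟩, hc, hl⟩ := f
  simp only at hc hl
  by_cases h : O.IsCell (across i j l).1 (across i j l).2
  · have h4 : ∀ l : Fin 4, l + 2 + 2 = l := by decide
    simp [cross, h, across_across, hc, h4]
  · simp [cross, h]

theorem cross_ne (f : O.Flag) : O.cross f ≠ f := by
  obtain ⟨⟨s, i, j, l⟩, hc, hl⟩ := f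
  have h4 : ∀ l : Fin 4, l + 2 ≠ l := by decide
  by_cases h : O.IsCell (across i j l).1 (across i j l).2
  · simp [cross, h, h4]
  · simp [cross, h]

theorem gridIndex_injective : Function.Injective
    (fun q : O.Square => ((q.1.1, q.1.2.1.toNat, q.1.2.2.toNat) : Bool × ℕ × ℕ)) := by
  rintro ⟨⟨s, i, j⟩, h, _⟩ ⟨⟨s', i', j'⟩, h', _⟩ he
  unfold IsCell at h h'
  simp only at h h'
  simp only [Prod.mk.injEq] at he
  simp only [Subtype.mk.injEq, Prod.mk.injEq]
  exact ⟨he.1, by omega, by omega⟩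

theorem gridIndex_mem (q : O.Square) : ((q.1.1, q.1.2.1.toNat, q.1.2.2.toNat) : Bool × ℕ × ℕ) ∈
    (Finset.univ ×ˢ Finset.range O.width ×ˢ Finset.range O.height :
      Finset (Bool × ℕ × ℕ)) := by
  obtain ⟨⟨s, i, j⟩, h, -⟩ := q
  unfold IsCell at h
  simp only at h
  simp only [Finset.mem_product, Finset.mem_univ, Finset.mem_range, true_and]
  omega

instance : Finite O.Square :=
  Finite.of_injective
    (fun q => (⟨_, O.gridIndex_mem q⟩ :
      (Finset.univ ×ˢ Finset.range O.width ×ˢ Finset.range O.height : Finset (Bool × ℕ × ℕ))))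
    (fun _ _ h => O.gridIndex_injective (Subtype.ext_iff.1 h))

theorem card_square_le : Nat.card O.Square ≤ 2 * (O.width * O.height) := by
  have h := Nat.card_le_card_of_injective
    (fun q => (⟨_, O.gridIndex_mem q⟩ :
      (Finset.univ ×ˢ Finset.range O.width ×ˢ Finset.range O.height : Finset (Bool × ℕ × ℕ))))
    (fun _ _ h => O.gridIndex_injective (Subtype.ext_iff.1 h))
  rwa [Nat.card_eq_fintype_card (α := ↥(_ : Finset (Bool × ℕ × ℕ))), Fintype.card_coe, Finset.card_product, Finset.card_product,
    Finset.card_range, Finset.card_range, Finset.card_univ, Fintype.card_bool] at h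

/-- A numbering of the squares. -/
noncomputable def numbering : Fin (Nat.card O.Square) ≃ O.Square :=
  (Finite.equivFin O.Square).symm

/-- The numbered sides of squares as sides of cells on the two sheets. -/
noncomputable def flagEquiv : Fin (Nat.card O.Square) × Fin 4 ≃ O.Flag :=
  (O.numbering.prodCongr (Equiv.refl _)).trans O.sideEquiv

/-- The gluing of squares that yields the doubly covered octagon. -/
noncomputable def gluing : SquareGluing (Nat.card O.Square) where
  partner x := O.flagEquiv.symm (O.cross (O.flagEquiv x))
  partner_partner x := by simp [cross_cross]
  partner_ne x h := O.cross_ne (O.flagEquiv x) (by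
    rw [Equiv.symm_apply_eq] at h; exact h)
  -- The upper sheet is drawn mirrored, which orients the double. Hence all sides are matched
  -- against the counterclockwise parametrizations, within a sheet as well as between the sheets.
  flipped _ := false
  flipped_partner _ := rfl

end LatticeOctagon

/-! ### Coordinates on cells and the reflection in a cut -/

namespace LatticeOctagon

variable (O : LatticeOctagon)

/-- The point lies in the closed lattice cell. -/
def InCell (i j : ℤ) (p : Plane) : Prop := (i ≤ p 0 ∧ p 0 ≤ i + 1) ∧ (j ≤ p 1 ∧ p 1 ≤ j + 1)

/-- Coordinates on a cell of one of the sheets; on the upper sheet they are mirrored. -/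
noncomputable def toSquare (s : Bool) (i j : ℤ) (p : Plane) : Plane :=
  if s then
    if O.AntiCut i j then !₂[1 - (p 1 - j), 1 - (p 0 - i)] else !₂[p 1 - j, p 0 - i]
  else !₂[p 0 - i, p 1 - j]

/-- The inverse of `toSquare`. -/
noncomputable def fromSquare (s : Bool) (i j : ℤ) (a : Plane) : Plane :=
  if s then
    if O.AntiCut i j then !₂[i + (1 - a 1), j + (1 - a 0)] else !₂[i + a 1, j + a 0]
  else !₂[i + a 0, j + a 1]

theorem toSquare_fromSquare (s : Bool) (i j : ℤ) (a : Plane) :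
    O.toSquare s i j (O.fromSquare s i j a) = a := by
  unfold toSquare fromSquare
  ext k; fin_cases k <;> split_ifs <;> simp

theorem edist_toSquare (s : Bool) (i j : ℤ) (p q : Plane) :
    edist (O.toSquare s i j p) (O.toSquare s i j q) = edist p q := by
  rw [edist_dist, edist_dist, EuclideanSpace.dist_eq, EuclideanSpace.dist_eq]
  congr 2
  unfold toSquare
  split_ifs <;> simp [Fin.sum_univ_two, Real.dist_eq, sq_abs] <;> ring

theorem toSquare_mem_unitSquare_iff (s : Bool) (i j : ℤ) (p : Plane) :
    O.toSquare s i j p ∈ unitSquare ↔ InCell i j p := by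
  simp only [unitSquare, InCell, toSquare, Set.mem_ofPred_eq, Fin.forall_fin_two, Set.mem_Icc]
  split_ifs <;> simp <;> constructor <;> rintro ⟨⟨h1, h2⟩, h3, h4⟩ <;>
    refine ⟨⟨?_, ?_⟩, ?_, ?_⟩ <;> linarith

theorem inCell_fromSquare {a : Plane} (ha : a ∈ unitSquare) (s : Bool) (i j : ℤ) :
    InCell i j (O.fromSquare s i j a) := by
  rwa [← O.toSquare_mem_unitSquare_iff s, toSquare_fromSquare]

variable {O}

/-- By integrality, a slanted inequality in `IsCell` that is strict holds with `1` to spare, enough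
for the whole closed cell. Only in the case of equality, where the cell is cut, is information about
the point needed. -/
theorem mem_region_of_inCell {i j : ℤ} (hc : O.IsCell i j) {p : Plane} (hp : InCell i j p)
    (h1 : i + j + 1 = O.bottomLeft → i + j + 1 ≤ p 0 + p 1)
    (h2 : O.width - i + j = O.bottomRight → p 0 - p 1 ≤ i - j)
    (h3 : O.width + O.height - i - j - 1 = O.topRight → p 0 + p 1 ≤ i + j + 1)
    (h4 : i + O.height - j = O.topLeft → i - j ≤ p 0 - p 1) : p ∈ O.region := by
  obtain ⟨⟨a1, a2⟩, a3, a4⟩ := hp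
  obtain ⟨c1, c2, c3, c4, c5, c6, c7, c8⟩ := hc
  have c1' : (0 : ℝ) ≤ i := by exact_mod_cast c1
  have c2' : (i : ℝ) + 1 ≤ O.width := by exact_mod_cast c2
  have c3' : (0 : ℝ) ≤ j := by exact_mod_cast c3
  have c4' : (j : ℝ) + 1 ≤ O.height := by exact_mod_cast c4
  refine ⟨by linarith, by linarith, by linarith, by linarith, ?_, ?_, ?_, ?_⟩
  · rcases c5.eq_or_lt with h | h
    · have : (O.bottomLeft : ℝ) = i + j + 1 := by exact_mod_cast h
      have := h1 h.symm; linarith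
    · have : (O.bottomLeft : ℝ) + 1 ≤ i + j + 1 := by exact_mod_cast h
      linarith
  · rcases c6.eq_or_lt with h | h
    · have : (O.bottomRight : ℝ) = O.width - i + j := by exact_mod_cast h
      have := h2 h.symm; linarith
    · have : (O.bottomRight : ℝ) + 1 ≤ O.width - i + j := by exact_mod_cast h
      linarith
  · rcases c7.eq_or_lt with h | h
    · have : (O.topRight : ℝ) = O.width + O.height - i - j - 1 := by exact_mod_cast h
      have := h3 h.symm; linarith
    · have : (O.topRight : ℝ) + 1 ≤ O.width + O.height - i - j - 1 := by exact_mod_cast h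
      linarith
  · rcases c8.eq_or_lt with h | h
    · have : (O.topLeft : ℝ) = i + O.height - j := by exact_mod_cast h
      have := h4 h.symm; linarith
    · have : (O.topLeft : ℝ) + 1 ≤ i + O.height - j := by exact_mod_cast h
      linarith

theorem fromSquare_mem_region_of_uncut {i j : ℤ} (hc : O.IsCell i j) (hu : O.Uncut i j) {a : Plane}
    (ha : a ∈ unitSquare) (s : Bool) : O.fromSquare s i j a ∈ O.region := by
  obtain ⟨hu1, hu2⟩ := hu
  unfold AntiCut at hu1
  unfold MainCut at hu2
  exact mem_region_of_inCell hc (O.inCell_fromSquare ha s i j) (fun h => absurd (Or.inl h) hu1)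
    (fun h => absurd (Or.inl h) hu2) (fun h => absurd (Or.inr h) hu1)
    (fun h => absurd (Or.inr h) hu2)

variable (O) in
/-- The signed distance, up to scaling, of a point to the diagonal of the cell along which the cell
is cut. -/
noncomputable def cutHeight (i j : ℤ) (p : Plane) : ℝ :=
  if O.AntiCut i j then p 0 + p 1 - (i + j + 1) else p 0 - p 1 - (i - j)

theorem toSquare_true_eq_false {i j : ℤ} {p : Plane} (h : O.cutHeight i j p = 0) :
    O.toSquare true i j p = O.toSquare false i j p := by
  unfold cutHeight at h
  unfold toSquare
  by_cases h' : O.AntiCut i j <;> simp only [h', if_true, if_false] at h <;>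
    ext k <;> fin_cases k <;> simp [h'] <;> linarith

/-- Changing sheets at a fixed point of the square reflects its position in the diagonal, and so
moves it to the opposite side. -/
theorem cutHeight_fromSquare_toSquare (i j : ℤ) (p : Plane) :
    O.cutHeight i j (O.fromSquare false i j (O.toSquare true i j p)) = - O.cutHeight i j p := by
  unfold cutHeight fromSquare toSquare
  by_cases h' : O.AntiCut i j <;> simp [h'] <;> ring

theorem mem_region_iff_of_inCell {i j : ℤ} (hc : O.IsCell i j) {p : Plane} (hp : InCell i j p) :
    p ∈ O.region ↔ (i + j + 1 = O.bottomLeft → (i : ℝ) + j + 1 ≤ p 0 + p 1) ∧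
      (O.width - i + j = O.bottomRight → p 0 - p 1 ≤ i - j) ∧
      (O.width + O.height - i - j - 1 = O.topRight → p 0 + p 1 ≤ i + j + 1) ∧
      (i + O.height - j = O.topLeft → i - j ≤ p 0 - p 1) := by
  refine ⟨?_, fun h => mem_region_of_inCell hc hp h.1 h.2.1 h.2.2.1 h.2.2.2⟩
  rintro ⟨-, -, -, -, a5, a6, a7, a8⟩
  refine ⟨fun h => ?_, fun h => ?_, fun h => ?_, fun h => ?_⟩
  · have h' : (i : ℝ) + j + 1 = O.bottomLeft := by exact_mod_cast h
    linarith
  · have h' : (O.width : ℝ) - i + j = O.bottomRight := by exact_mod_cast h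
    linarith
  · have h' : (O.width : ℝ) + O.height - i - j - 1 = O.topRight := by exact_mod_cast h
    linarith
  · have h' : (i : ℝ) + O.height - j = O.topLeft := by exact_mod_cast h
    linarith

/-- A cut cell meets the octagon in the half-cell on one side of the cut. -/
theorem exists_sign {i j : ℤ} (hc : O.IsCell i j) (hu : ¬ O.Uncut i j) :
    ∃ ε : ℝ, (ε = 1 ∨ ε = -1) ∧ ∀ p, InCell i j p →
      (p ∈ O.region ↔ 0 ≤ ε * O.cutHeight i j p) ∧
      (O.cutHeight i j p = 0 → p ∈ frontier O.region) := by
  have b1 := O.bottom_lt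
  have b2 := O.top_lt
  have b3 := O.left_lt
  have b4 := O.right_lt
  have h : i + j + 1 = O.bottomLeft ∨ O.width - i + j = O.bottomRight ∨
      O.width + O.height - i - j - 1 = O.topRight ∨ i + O.height - j = O.topLeft := by
    unfold Uncut AntiCut MainCut at hu
    omega
  have key : ∃ ε : ℝ, (ε = 1 ∨ ε = -1) ∧ ∀ p, InCell i j p →
      (p ∈ O.region ↔ 0 ≤ ε * O.cutHeight i j p) ∧ (O.cutHeight i j p = 0 → O.Tight p) := by
    have hc' := hc
    unfold IsCell at hc
    unfold cutHeight Tight AntiCut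
    rcases h with h | h | h | h
    · have hb : ¬ O.width - i + j = (O.bottomRight : ℤ) := by omega
      have hc : ¬ O.width + O.height - i - j - 1 = (O.topRight : ℤ) := by omega
      have hd : ¬ i + O.height - j = (O.topLeft : ℤ) := by omega
      refine ⟨1, Or.inl rfl, fun p hp => ?_⟩
      rw [mem_region_iff_of_inCell hc' hp]
      simp only [h, hb, hc, hd, true_or, if_true, false_implies, true_implies, and_true]
      have h' : (i : ℝ) + j + 1 = O.bottomLeft := by exact_mod_cast h
      refine ⟨by constructor <;> intro <;> linarith, fun h0 => ?_⟩
      iterate 4 right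
      left; linarith
    · have ha : ¬ i + j + 1 = (O.bottomLeft : ℤ) := by omega
      have hc : ¬ O.width + O.height - i - j - 1 = (O.topRight : ℤ) := by omega
      have hd : ¬ i + O.height - j = (O.topLeft : ℤ) := by omega
      refine ⟨-1, Or.inr rfl, fun p hp => ?_⟩
      rw [mem_region_iff_of_inCell hc' hp]
      simp only [h, ha, hc, hd, or_self, if_false, false_implies, true_implies, and_true, true_and]
      have h' : (O.width : ℝ) - i + j = O.bottomRight := by exact_mod_cast h
      refine ⟨by constructor <;> intro <;> linarith, fun h0 => ?_⟩
      iterate 5 right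
      left; linarith
    · have ha : ¬ i + j + 1 = (O.bottomLeft : ℤ) := by omega
      have hb : ¬ O.width - i + j = (O.bottomRight : ℤ) := by omega
      have hd : ¬ i + O.height - j = (O.topLeft : ℤ) := by omega
      refine ⟨-1, Or.inr rfl, fun p hp => ?_⟩
      rw [mem_region_iff_of_inCell hc' hp]
      simp only [h, ha, hb, hd, or_true, if_true, false_implies, true_implies, and_true, true_and]
      have h' : (O.width : ℝ) + O.height - i - j - 1 = O.topRight := by exact_mod_cast h
      refine ⟨by constructor <;> intro <;> linarith, fun h0 => ?_⟩
      iterate 6 right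
      left; linarith
    · have ha : ¬ i + j + 1 = (O.bottomLeft : ℤ) := by omega
      have hb : ¬ O.width - i + j = (O.bottomRight : ℤ) := by omega
      have hc : ¬ O.width + O.height - i - j - 1 = (O.topRight : ℤ) := by omega
      refine ⟨1, Or.inl rfl, fun p hp => ?_⟩
      rw [mem_region_iff_of_inCell hc' hp]
      simp only [h, ha, hb, hc, or_self, if_false, false_implies, true_implies, true_and]
      have h' : (i : ℝ) + O.height - j = O.topLeft := by exact_mod_cast h
      refine ⟨by constructor <;> intro <;> linarith, fun h0 => ?_⟩
      iterate 7 right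
      linarith
  obtain ⟨ε, hε, hkey⟩ := key
  refine ⟨ε, hε, fun p hp => ⟨(hkey p hp).1, fun h0 => mem_frontier_iff.2 ⟨?_, (hkey p hp).2 h0⟩⟩⟩
  rw [(hkey p hp).1, h0, mul_zero]

end LatticeOctagon

/-! ### Placing points of the squares on the two sheets -/

namespace LatticeOctagon

variable {O : LatticeOctagon}

/-- The point of the side `l` of the cell with parameter `t`. -/
noncomputable def cellSide (i j : ℤ) (l : Fin 4) (t : ℝ) : Plane :=
  !₂[i + sidePoint l t 0, j + sidePoint l t 1]

theorem sidePoint_mem_unitSquare (l : Fin 4) {t : ℝ} (ht : t ∈ Set.Icc (0 : ℝ) 1) :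
    sidePoint l t ∈ unitSquare := by
  obtain ⟨h0, h1⟩ := ht
  intro k
  fin_cases l <;> fin_cases k <;> simp [sidePoint] <;> first | exact ⟨h0, h1⟩ | exact ⟨h1, h0⟩

theorem inCell_cellSide (i j : ℤ) (l : Fin 4) {t : ℝ} (ht : t ∈ Set.Icc (0 : ℝ) 1) :
    InCell i j (cellSide i j l t) := by
  have h0 := sidePoint_mem_unitSquare l ht 0
  have h1 := sidePoint_mem_unitSquare l ht 1
  simp only [InCell, cellSide, Matrix.cons_val_zero, Matrix.cons_val_one]
  exact ⟨⟨by linarith [h0.1], by linarith [h0.2]⟩, by linarith [h1.1], by linarith [h1.2]⟩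

/-- Mirroring reverses the direction of the sides, hence `1 - t` on the upper sheet. -/
theorem toSquare_cellSide (s : Bool) (i j : ℤ) (l : Fin 4) (t : ℝ) :
    O.toSquare s i j (cellSide i j l t) =
      sidePoint (O.mirrorIf s i j l) (if s then 1 - t else t) := by
  unfold toSquare cellSide mirrorIf mirrorSide
  cases s
  · ext k; fin_cases k <;> simp
  · by_cases h : O.AntiCut i j <;> fin_cases l <;> ext k <;> fin_cases k <;> simp [h, sidePoint]

theorem cellSide_across (i j : ℤ) (l : Fin 4) (t : ℝ) :
    cellSide (across i j l).1 (across i j l).2 (l + 2) (1 - t) = cellSide i j l t := by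
  unfold cellSide
  fin_cases l <;> ext k <;> fin_cases k <;> simp [across, sidePoint]

theorem cellSide_mem_region {i j : ℤ} {l : Fin 4} (hc : O.IsCell i j) (hl : O.Inner i j l) {t : ℝ}
    (ht : t ∈ Set.Icc (0 : ℝ) 1) : cellSide i j l t ∈ O.region := by
  refine (mem_region_iff_of_inCell hc (inCell_cellSide i j l ht)).2 ?_
  obtain ⟨h0, h1⟩ := ht
  unfold Inner at hl
  obtain ⟨l1, l2, l3, l4⟩ := hl
  refine ⟨fun h => ?_, fun h => ?_, fun h => ?_, fun h => ?_⟩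
  · rcases l1 h with rfl | rfl <;> simp [cellSide, sidePoint] <;> linarith
  · rcases l2 h with rfl | rfl <;> simp [cellSide, sidePoint] <;> linarith
  · rcases l3 h with rfl | rfl <;> simp [cellSide, sidePoint] <;> linarith
  · rcases l4 h with rfl | rfl <;> simp [cellSide, sidePoint] <;> linarith

theorem cellSide_mem_frontier {i j : ℤ} {l : Fin 4} (hc : O.IsCell i j) (hl : O.Inner i j l)
    (hn : ¬ O.IsCell (across i j l).1 (across i j l).2) {t : ℝ} (ht : t ∈ Set.Icc (0 : ℝ) 1) :
    cellSide i j l t ∈ frontier O.region := by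
  refine mem_frontier_iff.2 ⟨cellSide_mem_region hc hl ht, ?_⟩
  -- Crossing an inner side cannot violate a slanted inequality, so a missing neighbour means that
  -- the side lies on the boundary of the rectangle.
  have hb : (l = 3 ∧ i = 0) ∨ (l = 1 ∧ i + 1 = O.width) ∨ (l = 0 ∧ j = 0) ∨
      (l = 2 ∧ j + 1 = O.height) := by
    unfold Inner at hl
    unfold IsCell at hc hn
    fin_cases l <;> simp [across] at hl hn ⊢ <;> omega
  unfold Tight
  rcases hb with ⟨rfl, h⟩ | ⟨rfl, h⟩ | ⟨rfl, h⟩ | ⟨rfl, h⟩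
  · left; simp [cellSide, sidePoint, h]
  · right; left
    have : (i : ℝ) + 1 = O.width := by exact_mod_cast h
    simp [cellSide, sidePoint, this]
  · right; right; left; simp [cellSide, sidePoint, h]
  · right; right; right; left
    have : (j : ℝ) + 1 = O.height := by exact_mod_cast h
    simp [cellSide, sidePoint, this]

variable (O) in
/-- The points of the squares of the gluing. -/
abbrev Pieces : Type := Fin (Nat.card O.Square) × unitSquare

/-- The point `x` of one of the squares is placed at the point `p` of the cell on the sheet `s`. -/
def Placed (x : O.Pieces) (s : Bool) (i j : ℤ) (p : Plane) : Prop :=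
  (O.numbering x.1).1 = (s && decide (O.Uncut i j), i, j) ∧ (x.2 : Plane) = O.toSquare s i j p

theorem Placed.isCell {x : O.Pieces} {s : Bool} {i j : ℤ} {p : Plane} (h : Placed x s i j p) :
    O.IsCell i j := by
  have := (O.numbering x.1).2.1
  rwa [h.1] at this

theorem Placed.inCell {x : O.Pieces} {s : Bool} {i j : ℤ} {p : Plane} (h : Placed x s i j p) :
    InCell i j p := by
  rw [← O.toSquare_mem_unitSquare_iff s, ← h.2]
  exact x.2.2

theorem exists_placed {i j : ℤ} (hc : O.IsCell i j) {p : Plane} (hp : InCell i j p) (s : Bool) :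
    ∃ x : O.Pieces, Placed x s i j p :=
  ⟨(O.numbering.symm ⟨(s && decide (O.Uncut i j), i, j), hc, by simp⟩,
    ⟨O.toSquare s i j p, (O.toSquare_mem_unitSquare_iff s i j p).2 hp⟩), by simp [Placed]⟩

theorem Placed.ext {x x' : O.Pieces} {s : Bool} {i j : ℤ} {p : Plane} (h : Placed x s i j p)
    (h' : Placed x' s i j p) : x = x' := by
  refine Prod.ext (O.numbering.injective (Subtype.ext ?_)) (Subtype.ext ?_)
  · rw [h.1, h'.1]
  · rw [h.2, h'.2]

theorem Placed.edist_le {x x' : O.Pieces} {s : Bool} {i j : ℤ} {p p' : Plane}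
    (h : Placed x s i j p) (h' : Placed x' s i j p') :
    edist (show GluedPieces O.gluing.Identifies from x)
      (show GluedPieces O.gluing.Identifies from x') ≤ edist p p' := by
  obtain ⟨k, a⟩ := x
  obtain ⟨k', a'⟩ := x'
  obtain rfl : k = k' := O.numbering.injective (Subtype.ext (by rw [h.1, h'.1]))
  refine (GluedPieces.edist_move k a a').trans ?_
  rw [Subtype.edist_eq, h.2, h'.2, O.edist_toSquare]

theorem placed_cellSide_iff (f : O.Flag) (t : ℝ) (x : O.Pieces) :
    Placed x f.1.1 f.1.2.1 f.1.2.2.1 (cellSide f.1.2.1 f.1.2.2.1 f.1.2.2.2 t) ↔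
      x.1 = (O.flagEquiv.symm f).1 ∧
        (x.2 : Plane) = sidePoint (O.flagEquiv.symm f).2 (if f.1.1 then 1 - t else t) := by
  unfold Placed
  rw [toSquare_cellSide]
  refine and_congr ?_ Iff.rfl
  have : (O.flagEquiv.symm f).1 = O.numbering.symm (O.sideEquiv.symm f).1 := rfl
  rw [this, Equiv.eq_symm_apply, Subtype.ext_iff]
  rfl

/-- The parameter on the side `cross f` of the point of the side `f` with parameter `t`. -/
noncomputable def crossParam (f : O.Flag) (t : ℝ) : ℝ :=
  if O.IsCell (across f.1.2.1 f.1.2.2.1 f.1.2.2.2).1 (across f.1.2.1 f.1.2.2.1 f.1.2.2.2).2 then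
    1 - t
  else t

/-- Exactly one reversal occurs in either case: neighbouring cells run along a common side in
opposite directions, and a change of sheet mirrors. This is what agrees with `flipped` being
`false`. -/
theorem crossParam_spec (f : O.Flag) (t : ℝ) :
    (if (O.cross f).1.1 then 1 - crossParam f t else crossParam f t) =
      1 - (if f.1.1 then 1 - t else t) := by
  obtain ⟨⟨s, i, j, l⟩, hf⟩ := f
  unfold crossParam cross
  split_ifs with h1 h2 h3 <;> simp_all

theorem cellSide_cross (f : O.Flag) (t : ℝ) :
    cellSide (O.cross f).1.2.1 (O.cross f).1.2.2.1 (O.cross f).1.2.2.2 (crossParam f t) =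
      cellSide f.1.2.1 f.1.2.2.1 f.1.2.2.2 t := by
  unfold crossParam cross
  split_ifs with h
  · exact cellSide_across _ _ _ _
  · rfl

/-- Translates the gluing into geometry: glued points are placed at the same point of the plane, on
a side and on the side reached by crossing it. -/
theorem identifies_iff (x x' : O.Pieces) : O.gluing.Identifies x x' ↔
    ∃ f : O.Flag, ∃ t ∈ Set.Icc (0 : ℝ) 1,
      Placed x f.1.1 f.1.2.1 f.1.2.2.1 (cellSide f.1.2.1 f.1.2.2.1 f.1.2.2.2 t) ∧
      Placed x' (O.cross f).1.1 (O.cross f).1.2.1 (O.cross f).1.2.2.1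
        (cellSide f.1.2.1 f.1.2.2.1 f.1.2.2.2 t) := by
  constructor
  · rintro ⟨k, l, t, ht, hp, hx, hx'⟩
    refine ⟨O.flagEquiv (x.1, k), if (O.flagEquiv (x.1, k)).1.1 then 1 - t else t, ?_, ?_, ?_⟩
    · split_ifs
      · exact ⟨by linarith [ht.2], by linarith [ht.1]⟩
      · exact ht
    · rw [placed_cellSide_iff, Equiv.symm_apply_apply]
      refine ⟨rfl, hx.trans ?_⟩
      split_ifs <;> simp
    · have hp' : O.flagEquiv.symm (O.cross (O.flagEquiv (x.1, k))) = (x'.1, l) := hp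
      rw [← cellSide_cross, placed_cellSide_iff, crossParam_spec, hp']
      refine ⟨rfl, hx'.trans ?_⟩
      have hf : O.gluing.flipped (x.1, k) = false := rfl
      rw [hf]
      split_ifs <;> simp_all
  · rintro ⟨f, t, ht, h, h'⟩
    rw [placed_cellSide_iff] at h
    rw [← cellSide_cross, placed_cellSide_iff, crossParam_spec] at h'
    refine ⟨(O.flagEquiv.symm f).2, (O.flagEquiv.symm (O.cross f)).2,
      if f.1.1 then 1 - t else t, ?_, ?_, h.2, h'.2⟩
    · split_ifs
      · exact ⟨by linarith [ht.2], by linarith [ht.1]⟩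
      · exact ht
    · rw [h.1, h'.1]
      change O.flagEquiv.symm (O.cross (O.flagEquiv (O.flagEquiv.symm f))) = _
      rw [Equiv.apply_symm_apply]

end LatticeOctagon

/-! ### Distances in the doubly covered region -/

/-- Two copies of `P`, with the gluing pseudometric of the doubly covered region. -/
abbrev Sheets (P : Set Plane) : Type :=
  GluedPieces (fun x y : Bool × P => x.2 = y.2 ∧ (x.2 : Plane) ∈ frontier P)

namespace Sheets

variable {P : Set Plane}

/-- The point `p` on the sheet `s`. -/
def pt (s : Bool) (p : P) : Sheets P := (s, p)

theorem edist_same_le (s : Bool) (p q : P) : edist (pt s p) (pt s q) ≤ edist p q :=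
  GluedPieces.edist_move s p q

theorem edist_pt_frontier {p : P} (hp : (p : Plane) ∈ frontier P) (s s' : Bool) :
    edist (pt s p) (pt s' p) = 0 :=
  GluedPieces.edist_jump ⟨rfl, hp⟩

theorem edist_le_of_frontier (s s' : Bool) (p : P) {q : P} (hq : (q : Plane) ∈ frontier P) :
    edist (pt s p) (pt s' q) ≤ edist p q :=
  (edist_triangle _ (pt s q) _).trans (by
    rw [edist_pt_frontier hq, add_zero]; exact edist_same_le s p q)

/-- Forgetting the sheet projects the double onto `P` without expanding distances. -/
theorem le_edist (s s' : Bool) (p q : P) : edist p q ≤ edist (pt s p) (pt s' q) := by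
  refine GluedPieces.edist_le_of_rel (fun x b => x.2 = b) (fun x => ⟨x.2, rfl⟩) ?_ ?_ rfl rfl
  · rintro i p q _ _ rfl rfl
    exact le_rfl
  · rintro x y _ _ ⟨h, -⟩ rfl rfl
    rw [h, edist_self]

end Sheets

/-- Intermediate value for an affine function, with the zero given explicitly by weights
proportional to `- f b` and `f a`. -/
theorem exists_mem_segment_eq_zero {E : Type*} [AddCommGroup E] [Module ℝ E] {a b : E} (f : E → ℝ)
    (hf : ∀ s t : ℝ, s + t = 1 → f (s • a + t • b) = s * f a + t * f b) (hab : f a * f b ≤ 0) :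
    ∃ c ∈ segment ℝ a b, f c = 0 := by
  by_cases h : f a = 0
  · exact ⟨a, left_mem_segment ℝ a b, h⟩
  have hne : f a - f b ≠ 0 := by
    intro h'
    have : f b = f a := by linarith
    rw [this] at hab
    exact h (mul_self_eq_zero.1 (le_antisymm hab (mul_self_nonneg _)))
  have h1 : 0 ≤ f a / (f a - f b) := by
    rw [div_nonneg_iff]
    rcases lt_or_gt_of_ne h with h | h
    · right; constructor <;> nlinarith
    · left; constructor <;> nlinarith
  have h2 : 0 ≤ - f b / (f a - f b) := by
    rw [div_nonneg_iff]
    rcases lt_or_gt_of_ne h with h | h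
    · right; constructor <;> nlinarith
    · left; constructor <;> nlinarith
  have hsum : - f b / (f a - f b) + f a / (f a - f b) = 1 := by
    rw [← add_div, div_eq_one_iff_eq hne]; ring
  refine ⟨_, ⟨- f b / (f a - f b), f a / (f a - f b), h2, h1, hsum, rfl⟩, ?_⟩
  rw [hf _ _ hsum]; ring

/-! ### From squares to sheets without expansion -/

namespace LatticeOctagon

variable {O : LatticeOctagon}

theorem mem_segment_edist {a b c : Plane} (h : b ∈ segment ℝ a c) :
    edist a b + edist b c = edist a c := by
  rw [edist_dist, edist_dist, edist_dist, ← ENNReal.ofReal_add dist_nonneg dist_nonneg,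
    (mem_segment_iff_wbtw.1 h).dist_add_dist]

/-- Folding a cut cell does not increase distances. -/
theorem edist_fold_le {i j : ℤ} (hc : O.IsCell i j) (hu : ¬ O.Uncut i j) {p p' : O.region}
    (hp : InCell i j p) (hp' : InCell i j p') :
    edist (Sheets.pt false p) (Sheets.pt true p') ≤
      edist (O.toSquare false i j p) (O.toSquare true i j p') := by
  obtain ⟨ε, hε, hsign⟩ := exists_sign hc hu
  -- `p''` is the reflection of `p'` in the cut, so `p` and `p''` lie on opposite sides and their
  -- segment meets the cut in a point `m`. There the sheet changes for free, and `m` is equally far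
  -- from `p'` and `p''`.
  set p'' : Plane := O.fromSquare false i j (O.toSquare true i j p') with hp''
  have hin'' : InCell i j p'' :=
    O.inCell_fromSquare ((O.toSquare_mem_unitSquare_iff true i j p').2 hp') false i j
  have hto : O.toSquare false i j p'' = O.toSquare true i j p' := O.toSquare_fromSquare _ _ _ _
  have hneg : O.cutHeight i j p'' = - O.cutHeight i j p' := cutHeight_fromSquare_toSquare i j _
  have h1 := (hsign p hp).1.1 p.2
  have h2 := (hsign p' hp').1.1 p'.2
  obtain ⟨m, hm, hm0⟩ : ∃ m ∈ segment ℝ (p : Plane) p'', O.cutHeight i j m = 0 := by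
    refine exists_mem_segment_eq_zero (O.cutHeight i j) ?_ ?_
    · intro s t hst
      obtain rfl : t = 1 - s := by linarith
      unfold cutHeight
      split_ifs <;> simp <;> ring
    · rw [hneg]
      rcases hε with rfl | rfl <;> nlinarith
  have hinm : InCell i j m := by
    obtain ⟨s, t, hs, ht, hst, rfl⟩ := hm
    obtain ⟨⟨a1, a2⟩, a3, a4⟩ := hp
    obtain ⟨⟨b1, b2⟩, b3, b4⟩ := hin''
    obtain rfl : t = 1 - s := by linarith
    simp only [InCell, PiLp.add_apply, PiLp.smul_apply, smul_eq_mul]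
    refine ⟨⟨?_, ?_⟩, ?_, ?_⟩ <;> nlinarith
  have hmf : m ∈ frontier O.region := (hsign m hinm).2 hm0
  have hmr : m ∈ O.region := (mem_frontier_iff.1 hmf).1
  calc edist (Sheets.pt false p) (Sheets.pt true p')
      ≤ edist (Sheets.pt false p) (Sheets.pt false (⟨m, hmr⟩ : O.region)) +
        edist (Sheets.pt false (⟨m, hmr⟩ : O.region)) (Sheets.pt true p') := edist_triangle _ _ _
    _ ≤ edist (p : Plane) m + edist (p' : Plane) m := by
        refine add_le_add (Sheets.edist_same_le _ _ _) ?_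
        rw [edist_comm]
        exact Sheets.edist_le_of_frontier true false p' hmf
    _ = edist (p : Plane) m + edist m p'' := by
        rw [edist_comm (p' : Plane) m, ← O.edist_toSquare true i j m p', toSquare_true_eq_false hm0,
          ← hto, O.edist_toSquare]
    _ = edist (p : Plane) p'' := mem_segment_edist hm
    _ = _ := by rw [← hto, O.edist_toSquare]

/-- A point of the squares and a point of the doubly covered octagon correspond to each other. -/
def Corr (x : GluedPieces O.gluing.Identifies) (y : Sheets O.region) : Prop :=
  ∃ i j : ℤ, Placed x y.1 i j y.2

theorem corr_move (k : Fin (Nat.card O.Square)) (a a' : unitSquare) (y y' : Sheets O.region)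
    (h : Corr (O := O) (k, a) y) (h' : Corr (O := O) (k, a') y') : edist y y' ≤ edist a a' := by
  obtain ⟨s, p⟩ := y
  obtain ⟨s', p'⟩ := y'
  obtain ⟨i, j, h⟩ := h
  obtain ⟨i', j', h'⟩ := h'
  have heq := h.1.symm.trans h'.1
  simp only [Prod.mk.injEq] at heq
  obtain ⟨hs, rfl, rfl⟩ := heq
  rw [Subtype.edist_eq]
  rw [show (a : Plane) = _ from h.2, show (a' : Plane) = _ from h'.2]
  by_cases hss : s = s'
  · subst hss
    rw [O.edist_toSquare]
    exact Sheets.edist_same_le s p p'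
  -- For an uncut cell the label of the square determines the sheet, so both sheets occur only in a
  -- folded square.
  · have hu : ¬ O.Uncut i j := by
      intro hu
      simp [hu] at hs
      exact hss hs
    cases s <;> cases s'
    · exact absurd rfl hss
    · exact edist_fold_le h.isCell hu h.inCell h'.inCell
    · exact (edist_comm _ _).trans_le
        ((edist_fold_le h.isCell hu h'.inCell h.inCell).trans_eq (edist_comm _ _))
    · exact absurd rfl hss

theorem corr_self {x : GluedPieces O.gluing.Identifies} {y y' : Sheets O.region}
    (h : Corr x y) (h' : Corr x y') : edist y y' = 0 := by
  obtain ⟨k, a⟩ := x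
  exact le_antisymm ((corr_move k a a y y' h h').trans_eq (edist_self a)) bot_le

/-- Both points are compared with the common point of the side on the sheets before and after
crossing. These sheets agree, or the side lies on the frontier, where the sheets are glued. -/
theorem corr_jump {x x' : GluedPieces O.gluing.Identifies} (y y' : Sheets O.region)
    (hxx' : O.gluing.Identifies x x') (h : Corr x y) (h' : Corr x' y') : edist y y' = 0 := by
  obtain ⟨f, t, ht, hf, hf'⟩ := (identifies_iff x x').1 hxx'
  have hr := cellSide_mem_region f.2.1 f.2.2 ht
  have e1 := corr_self h (y' := Sheets.pt f.1.1 ⟨_, hr⟩) ⟨_, _, hf⟩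
  have e2 := corr_self h' (y' := Sheets.pt (O.cross f).1.1 ⟨_, hr⟩) ⟨_, _, hf'⟩
  have e3 : edist (Sheets.pt f.1.1 ⟨_, hr⟩) (Sheets.pt (O.cross f).1.1 (⟨_, hr⟩ : O.region)) = 0 := by
    by_cases hc : O.IsCell (across f.1.2.1 f.1.2.2.1 f.1.2.2.2).1
        (across f.1.2.1 f.1.2.2.1 f.1.2.2.2).2
    · have : (O.cross f).1.1 = f.1.1 := by simp [cross, hc]
      rw [this, edist_self]
    · exact Sheets.edist_pt_frontier (cellSide_mem_frontier f.2.1 f.2.2 hc ht) _ _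
  rw [edist_comm] at e2
  refine le_antisymm ((edist_triangle4 y (Sheets.pt f.1.1 ⟨_, hr⟩)
    (Sheets.pt (O.cross f).1.1 ⟨_, hr⟩) y').trans_eq ?_) bot_le
  rw [e1, e3, e2]
  simp

theorem corr_left_total (x : GluedPieces O.gluing.Identifies) : ∃ y, Corr (O := O) x y := by
  obtain ⟨k, a⟩ := x
  obtain ⟨⟨⟨σ, i, j⟩, hc, hσ⟩, hk⟩ : ∃ q, O.numbering k = q := ⟨_, rfl⟩
  simp only at hc hσ
  have hin : ∀ s, InCell i j (O.fromSquare s i j a) := fun s => O.inCell_fromSquare a.2 s i j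
  have main : ∀ s, O.fromSquare s i j a ∈ O.region → σ = (s && decide (O.Uncut i j)) →
      ∃ y, Corr (O := O) (k, a) y := by
    intro s hs hσs
    refine ⟨(s, ⟨_, hs⟩), i, j, ?_, (O.toSquare_fromSquare s i j a).symm⟩
    change (O.numbering k).1 = _
    rw [hk]
    exact Prod.ext hσs rfl
  by_cases hu : O.Uncut i j
  · exact main σ (fromSquare_mem_region_of_uncut hc hu a.2 σ) (by simp [hu])
  · have hσ' : σ = false := by
      cases σ
      · rfl
      · exact absurd (hσ rfl) hu
    obtain ⟨ε, hε, hsign⟩ := exists_sign hc hu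
    by_cases h0 : O.fromSquare false i j a ∈ O.region
    · exact main false h0 (by simp [hσ'])
    -- A point of a folded square outside the octagon has its mirror image in the other half, hence
    -- in the octagon, and is placed on the upper sheet.
    · refine main true ?_ (by simp [hσ', hu])
      rw [(hsign _ (hin true)).1]
      rw [(hsign _ (hin false)).1] at h0
      have := cutHeight_fromSquare_toSquare (O := O) i j (O.fromSquare true i j a)
      rw [O.toSquare_fromSquare] at this
      rw [this] at h0
      linarith

end LatticeOctagon

/-- The floor works except at the right end, where `b - 1` replaces it so that the cell does not
leave the interval; the last clause records which case occurred. -/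
theorem exists_int_between {a b : ℤ} (hab : a < b) {x : ℝ} (ha : a ≤ x) (hb : x ≤ b) :
    ∃ k : ℤ, a ≤ k ∧ k < b ∧ k ≤ x ∧ x ≤ k + 1 ∧ (x < k + 1 ∨ x = b ∧ k + 1 = b) := by
  rcases hb.eq_or_lt with h | h
  · refine ⟨b - 1, by omega, by omega, ?_, ?_, Or.inr ⟨h, by ring⟩⟩ <;> push_cast <;> linarith
  · exact ⟨⌊x⌋, Int.le_floor.2 ha, Int.floor_lt.2 h, Int.floor_le x, (Int.lt_floor_add_one x).le,
      Or.inl (Int.lt_floor_add_one x)⟩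

/-! ### From sheets to squares without expansion -/

namespace LatticeOctagon

variable {O : LatticeOctagon}

theorem inner_of_isCell_across {i j : ℤ} {l : Fin 4}
    (hc' : O.IsCell (across i j l).1 (across i j l).2) : O.Inner i j l := by
  unfold Inner
  unfold IsCell at hc'
  fin_cases l <;> simp [across] at hc' ⊢ <;> omega

/-- Two cells that meet only in a corner have a common neighbour among the cells. This links squares
around a lattice point, although only sides are glued. -/
theorem isCell_or_isCell {i j i' j' : ℤ} (h : O.IsCell i j) (h' : O.IsCell i' j')
    (hi : i ≤ i' + 1) (hi' : i' ≤ i + 1) (hj : j ≤ j' + 1) (hj' : j' ≤ j + 1) :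
    O.IsCell i' j ∨ O.IsCell i j' := by
  have b1 := O.bottom_lt
  have b2 := O.top_lt
  have b3 := O.left_lt
  have b4 := O.right_lt
  unfold IsCell at h h' ⊢
  obtain rfl | rfl | rfl : i' = i ∨ i' = i + 1 ∨ i' = i - 1 := by omega
  · left; omega
  all_goals
    obtain rfl | rfl | rfl : j' = j ∨ j' = j + 1 ∨ j' = j - 1 := by omega
    · left; omega
    all_goals
      by_contra hcon
      rw [not_or] at hcon
      omega

theorem eq_cellSide {i j : ℤ} {l : Fin 4} {p : Plane} (h : InCell i j p)
    (h' : InCell (across i j l).1 (across i j l).2 p) :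
    ∃ t ∈ Set.Icc (0 : ℝ) 1, p = cellSide i j l t := by
  obtain ⟨⟨a1, a2⟩, a3, a4⟩ := h
  obtain ⟨⟨b1, b2⟩, b3, b4⟩ := h'
  fin_cases l <;> simp [across] at b1 b2 b3 b4
  · refine ⟨p 0 - i, ⟨by linarith, by linarith⟩, ?_⟩
    ext k; fin_cases k <;> simp [cellSide, sidePoint]; linarith
  · refine ⟨p 1 - j, ⟨by linarith, by linarith⟩, ?_⟩
    ext k; fin_cases k <;> simp [cellSide, sidePoint]; linarith
  · refine ⟨1 - (p 0 - i), ⟨by linarith, by linarith⟩, ?_⟩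
    ext k; fin_cases k <;> simp [cellSide, sidePoint]; linarith
  · refine ⟨1 - (p 1 - j), ⟨by linarith, by linarith⟩, ?_⟩
    ext k; fin_cases k <;> simp [cellSide, sidePoint]; linarith

variable (O) in
/-- The squares with the gluing pseudometric. -/
abbrev Glued : Type := GluedPieces O.gluing.Identifies

theorem Placed.edist_across {x x' : O.Glued} {s : Bool} {i j : ℤ} {l : Fin 4} {p : Plane}
    (h : Placed x s i j p) (h' : Placed x' s (across i j l).1 (across i j l).2 p) :
    edist x x' = 0 := by
  obtain ⟨t, ht, rfl⟩ := eq_cellSide h.inCell h'.inCell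
  refine GluedPieces.edist_jump ((identifies_iff x x').2
    ⟨⟨(s, i, j, l), h.isCell, inner_of_isCell_across h'.isCell⟩, t, ht, h, ?_⟩)
  have hc := h'.isCell
  simpa [cross, hc] using h'

/-- Two cells containing `p` coincide, share a side, or touch at a corner; in the last case a third
cell mediates by one horizontal and one vertical crossing. -/
theorem Placed.edist_eq_zero {x x' : O.Glued} {s : Bool} {i j i' j' : ℤ} {p : Plane}
    (h : Placed x s i j p) (h' : Placed x' s i' j' p) : edist x x' = 0 := by
  have horiz : ∀ {x x' : O.Glued} {i i' j : ℤ}, Placed x s i j p → Placed x' s i' j p →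
      i ≤ i' + 1 → i' ≤ i + 1 → edist x x' = 0 := by
    intro x x' i i' j h h' hi hi'
    obtain rfl | rfl | rfl : i' = i ∨ i' = i + 1 ∨ i' = i - 1 := by omega
    · rw [h.ext h', edist_self]
    · exact Placed.edist_across (l := 1) h h'
    · exact Placed.edist_across (l := 3) h h'
  have vert : ∀ {x x' : O.Glued} {i j j' : ℤ}, Placed x s i j p → Placed x' s i j' p →
      j ≤ j' + 1 → j' ≤ j + 1 → edist x x' = 0 := by
    intro x x' i j j' h h' hj hj'
    obtain rfl | rfl | rfl : j' = j ∨ j' = j + 1 ∨ j' = j - 1 := by omega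
    · rw [h.ext h', edist_self]
    · exact Placed.edist_across (l := 2) h h'
    · exact Placed.edist_across (l := 0) h h'
  have hp := h.inCell
  have hp' := h'.inCell
  obtain ⟨⟨a1, a2⟩, a3, a4⟩ := h.inCell
  obtain ⟨⟨b1, b2⟩, b3, b4⟩ := h'.inCell
  have hi : i ≤ i' + 1 := by
    have h : (i : ℝ) ≤ i' + 1 := a1.trans b2
    exact_mod_cast h
  have hi' : i' ≤ i + 1 := by
    have h : (i' : ℝ) ≤ i + 1 := b1.trans a2
    exact_mod_cast h
  have hj : j ≤ j' + 1 := by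
    have h : (j : ℝ) ≤ j' + 1 := a3.trans b4
    exact_mod_cast h
  have hj' : j' ≤ j + 1 := by
    have h : (j' : ℝ) ≤ j + 1 := b3.trans a4
    exact_mod_cast h
  rcases isCell_or_isCell h.isCell h'.isCell hi hi' hj hj' with hc | hc
  · obtain ⟨z, hz⟩ := exists_placed hc ⟨hp'.1, hp.2⟩ s
    refine le_antisymm ((edist_triangle x z x').trans ?_) bot_le
    rw [horiz h hz hi hi', vert hz h' hj hj', add_zero]
  · obtain ⟨z, hz⟩ := exists_placed hc ⟨hp.1, hp'.2⟩ s
    refine le_antisymm ((edist_triangle x z x').trans ?_) bot_le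
    rw [vert h hz hj hj', horiz hz h' hi hi', add_zero]

/-- Every point of the octagon lies in a cell. -/
theorem exists_isCell {p : Plane} (hp : p ∈ O.region) : ∃ i j, O.IsCell i j ∧ InCell i j p := by
  have b1 := O.bottom_lt
  have b2 := O.top_lt
  have b3 := O.left_lt
  have b4 := O.right_lt
  have c1 := O.bottomLeft_pos
  have c2 := O.bottomRight_pos
  have c3 := O.topRight_pos
  have c4 := O.topLeft_pos
  obtain ⟨a1, a2, a3, a4, a5, a6, a7, a8⟩ := hp
  obtain ⟨i, i1, i2, i3, i4, i5⟩ := exists_int_between (a := 0) (b := O.width) (x := p 0) (by omega)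
    (by simpa using a1) (by simpa using a2)
  obtain ⟨j, j1, j2, j3, j4, j5⟩ := exists_int_between (a := 0) (b := O.height) (x := p 1) (by omega)
    (by simpa using a3) (by simpa using a4)
  have e1 : (O.bottomLeft : ℤ) ≤ i + j + 1 := by
    have : (O.bottomLeft : ℝ) ≤ i + j + 2 := by linarith
    have h : (O.bottomLeft : ℤ) ≤ i + j + 2 := by exact_mod_cast this
    rcases i5 with i5 | ⟨i5, i6⟩
    · have : (O.bottomLeft : ℝ) < i + j + 2 := by linarith
      have h : (O.bottomLeft : ℤ) < i + j + 2 := by exact_mod_cast this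
      omega
    · omega
  have e2 : (O.bottomRight : ℤ) ≤ O.width - i + j := by
    rcases j5 with j5 | ⟨j5, j6⟩
    · have : (O.bottomRight : ℝ) < O.width - i + j + 1 := by linarith
      have h : (O.bottomRight : ℤ) < O.width - i + j + 1 := by exact_mod_cast this
      omega
    · omega
  have e4 : (O.topLeft : ℤ) ≤ i + O.height - j := by
    rcases i5 with i5 | ⟨i5, i6⟩
    · have : (O.topLeft : ℝ) < i + O.height - j + 1 := by linarith
      have h : (O.topLeft : ℤ) < i + O.height - j + 1 := by exact_mod_cast this
      omega
    · omega
  have e3 : (O.topRight : ℤ) ≤ O.width + O.height - i - j := by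
    have : (O.topRight : ℝ) ≤ O.width + O.height - i - j := by linarith
    exact_mod_cast this
  -- With equality, the cell `(i, j)` lies beyond the top right edge and `p` can only be its lower
  -- left corner; the cell `(i - 1, j - 1)` contains it as well.
  rcases e3.eq_or_lt with e3 | e3
  · have e3' : (O.topRight : ℝ) = O.width + O.height - i - j := by exact_mod_cast e3
    refine ⟨i - 1, j - 1, ?_, ⟨?_, ?_⟩, ?_, ?_⟩
    · unfold IsCell; omega
    all_goals push_cast; linarith
  · exact ⟨i, j, by unfold IsCell; omega, ⟨i3, i4⟩, j3, j4⟩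

theorem exists_placed_of_boundary {i j : ℤ} {l : Fin 4} (hc : O.IsCell i j) (hl : O.Inner i j l)
    (hn : ¬ O.IsCell (across i j l).1 (across i j l).2) {t : ℝ} (ht : t ∈ Set.Icc (0 : ℝ) 1) :
    ∃ z z' : O.Glued, ∃ i' j' : ℤ, Placed z false i' j' (cellSide i j l t) ∧
      Placed z' true i' j' (cellSide i j l t) ∧ edist z z' = 0 := by
  obtain ⟨z, hz⟩ := exists_placed hc (inCell_cellSide i j l ht) false
  obtain ⟨z', hz'⟩ := exists_placed hc (inCell_cellSide i j l ht) true
  refine ⟨z, z', i, j, hz, hz', GluedPieces.edist_jump ((identifies_iff z z').2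
    ⟨⟨(false, i, j, l), hc, hl⟩, t, ht, hz, ?_⟩)⟩
  simpa [cross, hn] using hz'

/-- A point on the cut is its own mirror image, so one point of the folded square lies on both
sheets and serves as `z` and `z'`. -/
theorem exists_placed_of_cut {i j : ℤ} (hc : O.IsCell i j) (hu : ¬ O.Uncut i j) {p : Plane}
    (hp : InCell i j p) (h0 : O.cutHeight i j p = 0) :
    ∃ z z' : O.Glued, ∃ i' j' : ℤ, Placed z false i' j' p ∧ Placed z' true i' j' p ∧
      edist z z' = 0 := by
  obtain ⟨z, hz⟩ := exists_placed hc hp false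
  refine ⟨z, z, i, j, hz, ⟨?_, ?_⟩, edist_self _⟩
  · rw [hz.1]; simp [hu]
  · rw [toSquare_true_eq_false h0]; exact hz.2

/-- The sheets are joined in two ways: along axis-parallel edges by gluing sides of two squares,
along slanted edges by folding a square. -/
theorem exists_placed_of_frontier {p : Plane} (hp : p ∈ frontier O.region) :
    ∃ z z' : O.Glued, ∃ i j : ℤ, Placed z false i j p ∧ Placed z' true i j p ∧ edist z z' = 0 := by
  have b1 := O.bottom_lt
  have b2 := O.top_lt
  have b3 := O.left_lt
  have b4 := O.right_lt
  have c1 := O.bottomLeft_pos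
  have c2 := O.bottomRight_pos
  have c3 := O.topRight_pos
  have c4 := O.topLeft_pos
  obtain ⟨⟨a1, a2, a3, a4, a5, a6, a7, a8⟩, ht⟩ := mem_frontier_iff.1 hp
  rcases ht with h | h | h | h | h | h | h | h
  · obtain ⟨j, j1, j2, j3, j4, -⟩ := exists_int_between (a := O.bottomLeft)
      (b := O.height - O.topLeft) (x := p 1) (by omega) (by push_cast; linarith)
      (by push_cast; linarith)
    have hp' : p = cellSide 0 j 3 (1 - (p 1 - j)) := by
      ext k; fin_cases k <;> simp [cellSide, sidePoint]; linarith
    rw [hp']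
    exact exists_placed_of_boundary (by unfold IsCell; omega) (by unfold Inner; omega)
      (by simp [across, IsCell]) ⟨by linarith, by linarith⟩
  · obtain ⟨j, j1, j2, j3, j4, -⟩ := exists_int_between (a := O.bottomRight)
      (b := O.height - O.topRight) (x := p 1) (by omega) (by push_cast; linarith)
      (by push_cast; linarith)
    have hp' : p = cellSide (O.width - 1) j 1 (p 1 - j) := by
      ext k; fin_cases k <;> simp [cellSide, sidePoint]; linarith
    rw [hp']
    exact exists_placed_of_boundary (by unfold IsCell; omega) (by unfold Inner; omega)
      (by simp [across, IsCell]) ⟨by linarith, by linarith⟩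
  · obtain ⟨i, i1, i2, i3, i4, -⟩ := exists_int_between (a := O.bottomLeft)
      (b := O.width - O.bottomRight) (x := p 0) (by omega) (by push_cast; linarith)
      (by push_cast; linarith)
    have hp' : p = cellSide i 0 0 (p 0 - i) := by
      ext k; fin_cases k <;> simp [cellSide, sidePoint]; linarith
    rw [hp']
    exact exists_placed_of_boundary (by unfold IsCell; omega) (by unfold Inner; omega)
      (by simp [across, IsCell]) ⟨by linarith, by linarith⟩
  · obtain ⟨i, i1, i2, i3, i4, -⟩ := exists_int_between (a := O.topLeft)
      (b := O.width - O.topRight) (x := p 0) (by omega) (by push_cast; linarith)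
      (by push_cast; linarith)
    have hp' : p = cellSide i (O.height - 1) 2 (1 - (p 0 - i)) := by
      ext k; fin_cases k <;> simp [cellSide, sidePoint]; linarith
    rw [hp']
    exact exists_placed_of_boundary (by unfold IsCell; omega) (by unfold Inner; omega)
      (by simp [across, IsCell]) ⟨by linarith, by linarith⟩
  · obtain ⟨i, i1, i2, i3, i4, -⟩ := exists_int_between (a := 0)
      (b := O.bottomLeft) (x := p 0) (by omega) (by push_cast; linarith) (by push_cast; linarith)
    have hA : O.AntiCut i (O.bottomLeft - 1 - i) := by left; ring
    refine exists_placed_of_cut (i := i) (j := O.bottomLeft - 1 - i) (by unfold IsCell; omega)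
      (fun hu => hu.1 hA) ⟨⟨i3, i4⟩, by push_cast; linarith, by push_cast; linarith⟩ ?_
    simp only [cutHeight, hA, if_true]; push_cast; linarith
  · obtain ⟨j, j1, j2, j3, j4, -⟩ := exists_int_between (a := 0)
      (b := O.bottomRight) (x := p 1) (by omega) (by push_cast; linarith) (by push_cast; linarith)
    have hM : O.MainCut (O.width + j - O.bottomRight) j := by left; ring
    have hA : ¬ O.AntiCut (O.width + j - O.bottomRight) j := by unfold AntiCut; omega
    refine exists_placed_of_cut (i := O.width + j - O.bottomRight) (j := j)
      (by unfold IsCell; omega)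
      (fun hu => hu.2 hM) ⟨⟨by push_cast; linarith, by push_cast; linarith⟩, j3, j4⟩ ?_
    simp only [cutHeight, hA, if_false]; push_cast; linarith
  · obtain ⟨i, i1, i2, i3, i4, -⟩ := exists_int_between (a := O.width - O.topRight)
      (b := O.width) (x := p 0) (by omega) (by push_cast; linarith) (by push_cast; linarith)
    have hA : O.AntiCut i (O.width + O.height - O.topRight - 1 - i) := by right; ring
    refine exists_placed_of_cut (i := i) (j := O.width + O.height - O.topRight - 1 - i)
      (by unfold IsCell; omega)
      (fun hu => hu.1 hA) ⟨⟨i3, i4⟩, by push_cast; linarith, by push_cast; linarith⟩ ?_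
    simp only [cutHeight, hA, if_true]; push_cast; linarith
  · obtain ⟨i, i1, i2, i3, i4, -⟩ := exists_int_between (a := 0)
      (b := O.topLeft) (x := p 0) (by omega) (by push_cast; linarith) (by push_cast; linarith)
    have hM : O.MainCut i (i + O.height - O.topLeft) := by right; ring
    have hA : ¬ O.AntiCut i (i + O.height - O.topLeft) := by unfold AntiCut; omega
    refine exists_placed_of_cut (i := i) (j := i + O.height - O.topLeft) (by unfold IsCell; omega)
      (fun hu => hu.2 hM) ⟨⟨i3, i4⟩, by push_cast; linarith, by push_cast; linarith⟩ ?_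
    simp only [cutHeight, hA, if_false]; push_cast; linarith

theorem Placed.edist_eq_zero_of_frontier {x x' : O.Glued} {s s' : Bool} {i j i' j' : ℤ} {p : Plane}
    (hp : p ∈ frontier O.region) (h : Placed x s i j p) (h' : Placed x' s' i' j' p) :
    edist x x' = 0 := by
  obtain ⟨z, z', i₀, j₀, hz, hz', h0⟩ := exists_placed_of_frontier hp
  cases s <;> cases s'
  · exact h.edist_eq_zero h'
  · refine le_antisymm ((edist_triangle4 x z z' x').trans ?_) bot_le
    rw [h.edist_eq_zero hz, h0, hz'.edist_eq_zero h']; simp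
  · refine le_antisymm ((edist_triangle4 x z' z x').trans ?_) bot_le
    rw [h.edist_eq_zero hz', edist_comm z' z, h0, hz.edist_eq_zero h']; simp
  · exact h.edist_eq_zero h'

theorem corr_right_total (y : Sheets O.region) : ∃ x : O.Glued, Corr x y := by
  obtain ⟨s, p⟩ := y
  obtain ⟨i, j, hc, hp⟩ := exists_isCell p.2
  obtain ⟨x, hx⟩ := exists_placed hc hp s
  exact ⟨x, i, j, hx⟩

/-- Along a segment on one sheet, distances in the glued squares do not exceed the length. -/
theorem edist_le_of_corr {s : Bool} {p q : O.region} {x x' : O.Glued}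
    (h : Corr x (Sheets.pt s p)) (h' : Corr x' (Sheets.pt s q)) : edist x x' ≤ edist p q := by
  set γ : ℝ → Plane := fun t => AffineMap.lineMap (p : Plane) (q : Plane) t with hγ
  have hγc : Continuous γ := AffineMap.lineMap_continuous
  have hmem : ∀ t ∈ Set.Icc (0 : ℝ) 1, γ t ∈ O.region := fun t ht =>
    O.convex_region.lineMap_mem p.2 q.2 ht
  have hex : ∀ t : ℝ, ∃ z : O.Glued, t ∈ Set.Icc (0 : ℝ) 1 → ∃ i j, Placed z s i j (γ t) := by
    intro t
    by_cases ht : t ∈ Set.Icc (0 : ℝ) 1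
    · obtain ⟨z, hz⟩ := corr_right_total (Sheets.pt s ⟨γ t, hmem t ht⟩)
      exact ⟨z, fun _ => hz⟩
    · exact ⟨x, fun h => absurd h ht⟩
  -- The choice of `f` is arbitrary where cells overlap, but all placements of a point on sheet `s`
  -- are at distance zero, so `f` can be compared on each cell with placements in that cell.
  choose f hf using hex
  let C : ℤ × ℤ → Set ℝ := fun k => {t | (t ∈ Set.Icc (0 : ℝ) 1 ∧ InCell k.1 k.2 (γ t)) ∧
    O.IsCell k.1 k.2}
  have hC : ∀ k, IsClosed (C k) := by
    intro k
    have h0 : Continuous fun t => γ t 0 := (continuous_coord 0).comp hγc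
    have h1 : Continuous fun t => γ t 1 := (continuous_coord 1).comp hγc
    refine IsClosed.and (IsClosed.and isClosed_Icc ?_) isClosed_const
    exact ((isClosed_le continuous_const h0).and (isClosed_le h0 continuous_const)).and
      ((isClosed_le continuous_const h1).and (isClosed_le h1 continuous_const))
  have hlip : ∀ k, ∀ t ∈ C k, ∀ t' ∈ C k,
      edist (f t) (f t') ≤ edist (p : Plane) q * edist t t' := by
    rintro ⟨i, j⟩ t ⟨⟨ht, hin⟩, hc⟩ t' ⟨⟨ht', hin'⟩, -⟩
    obtain ⟨z, hz⟩ : ∃ z : O.Glued, Placed z s i j _ := exists_placed hc hin s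
    obtain ⟨z', hz'⟩ : ∃ z : O.Glued, Placed z s i j _ := exists_placed hc hin' s
    obtain ⟨_, _, hft⟩ := hf t ht
    obtain ⟨_, _, hft'⟩ := hf t' ht'
    calc edist (f t) (f t') ≤ edist (f t) z + edist z z' + edist z' (f t') :=
          edist_triangle4 _ _ _ _
      _ = edist z z' := by
          rw [hft.edist_eq_zero hz, hz'.edist_eq_zero hft', zero_add, add_zero]
      _ ≤ edist (γ t) (γ t') := hz.edist_le hz'
      _ = edist (p : Plane) q * edist t t' := by
          rw [edist_dist, edist_dist, edist_dist, dist_lineMap_lineMap, mul_comm,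
            ENNReal.ofReal_mul dist_nonneg]
  have hcov : Set.Icc (0 : ℝ) 1 ⊆
      ⋃ k ∈ Finset.Icc (0 : ℤ) O.width ×ˢ Finset.Icc (0 : ℤ) O.height, C k := by
    intro t ht
    obtain ⟨i, j, hc, hin⟩ := exists_isCell (hmem t ht)
    simp only [Set.mem_iUnion]
    refine ⟨(i, j), ?_, ⟨ht, hin⟩, hc⟩
    unfold IsCell at hc
    simp only [Finset.mem_product, Finset.mem_Icc]
    omega
  have hmain := edist_le_of_finite_closed_cover f (edist (p : Plane) q) C hC hlip _ 0 1 zero_le_one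
    hcov
  have h01 : edist (0 : ℝ) 1 = 1 := by simp [edist_dist]
  rw [h01, mul_one] at hmain
  obtain ⟨_, _, h⟩ := h
  obtain ⟨_, _, h'⟩ := h'
  obtain ⟨_, _, hf0⟩ := hf 0 ⟨le_rfl, zero_le_one⟩
  obtain ⟨_, _, hf1⟩ := hf 1 ⟨zero_le_one, le_rfl⟩
  have hγ0 : γ 0 = p := AffineMap.lineMap_apply_zero _ _
  have hγ1 : γ 1 = q := AffineMap.lineMap_apply_one _ _
  rw [hγ0] at hf0
  rw [hγ1] at hf1
  refine (edist_triangle4 x (f 0) (f 1) x').trans ?_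
  rw [Placed.edist_eq_zero h hf0, hf1.edist_eq_zero h', zero_add, add_zero]
  exact hmain

/-- The gluing yields the doubly covered octagon. -/
theorem nonempty_surface_isometryEquiv (O : LatticeOctagon) :
    Nonempty (O.gluing.Surface ≃ᵢ DoublyCovered O.region) := by
  refine nonempty_isometryEquiv_of_rel (A := O.Glued) (B := Sheets O.region) Corr
    -- The same chain argument is applied to the correspondence and to its converse.
    corr_left_total corr_right_total fun x x' y y' h h' => le_antisymm ?_ ?_
  · exact GluedPieces.edist_le_of_rel Corr corr_left_total corr_move
      (fun x x' y y' hr h h' => corr_jump y y' hr h h') h h'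
  · refine GluedPieces.edist_le_of_rel (fun (y : Sheets O.region) (x : O.Glued) => Corr x y)
      corr_right_total (fun s p q x x' h h' => edist_le_of_corr h h') ?_ h h'
    rintro ⟨s, p⟩ ⟨s', q⟩ x x' ⟨hpq, hfr⟩ ⟨_, _, h⟩ ⟨_, _, h'⟩
    have hpq' : p = q := hpq
    subst hpq'
    exact Placed.edist_eq_zero_of_frontier hfr h h'

end LatticeOctagon

/-! ### Metric recognition of the vertices -/

/-- The point lies strictly between two other points. -/
def IsStrictlyBetween {T : Type} [EDist T] (z : T) : Prop :=
  ∃ a b : T, a ≠ z ∧ b ≠ z ∧ edist a b = edist a z + edist z b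

theorem IsStrictlyBetween.map {T T' : Type} [PseudoEMetricSpace T] [PseudoEMetricSpace T'] {z : T}
    (h : IsStrictlyBetween z) (f : T ≃ᵢ T') : IsStrictlyBetween (f z) := by
  obtain ⟨a, b, ha, hb, hab⟩ := h
  exact ⟨f a, f b, f.injective.ne ha, f.injective.ne hb, by simpa only [f.isometry.edist_eq]⟩

namespace DoublyCovered

variable {P : Set Plane}

/-- The point of the doubly covered region over `p` on the sheet `s`. -/
noncomputable def pt (s : Bool) (p : P) : DoublyCovered P := SeparationQuotient.mk (Sheets.pt s p)

theorem exists_eq_pt (z : DoublyCovered P) : ∃ s p, z = pt s p := by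
  obtain ⟨⟨s, p⟩, rfl⟩ := SeparationQuotient.surjective_mk z
  exact ⟨s, p, rfl⟩

theorem edist_pt (s : Bool) (p q : P) : edist (pt s p) (pt s q) = edist p q :=
  (SeparationQuotient.edist_mk _ _).trans
    (le_antisymm (Sheets.edist_same_le s p q) (Sheets.le_edist s s p q))

theorem edist_pt_of_frontier (s s' : Bool) (p : P) {q : P} (hq : (q : Plane) ∈ frontier P) :
    edist (pt s p) (pt s' q) = edist p q :=
  (SeparationQuotient.edist_mk _ _).trans
    (le_antisymm (Sheets.edist_le_of_frontier s s' p hq) (Sheets.le_edist s s' p q))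

theorem pt_ne_pt {s : Bool} {p q : P} (h : p ≠ q) : pt s p ≠ pt s q := by
  intro h'
  have := edist_pt s p q
  rw [h', edist_self] at this
  exact h (edist_eq_zero.1 this.symm)

theorem pt_eq_pt_of_frontier (s s' : Bool) {p : P} (hp : (p : Plane) ∈ frontier P) :
    pt s p = pt s' p := by
  rw [← edist_eq_zero, edist_pt_of_frontier s s' p hp, edist_self]

end DoublyCovered

namespace LatticeOctagon

variable {O : LatticeOctagon}

theorem vertex_mem_frontier (k : Fin 8) : O.vertex k ∈ frontier O.region := by
  obtain ⟨r1, r2, r3, r4, r5, r6, r7, r8⟩ := O.real_bounds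
  refine mem_frontier_iff.2 ⟨?_, ?_⟩
  · unfold region
    fin_cases k <;> simp only [vertex, Set.mem_ofPred_eq, Matrix.cons_val_zero,
      Matrix.cons_val_one] <;> refine ⟨?_, ?_, ?_, ?_, ?_, ?_, ?_, ?_⟩ <;> linarith
  · unfold Tight
    fin_cases k <;> simp [vertex]

variable (O) in
/-- The vertices as points of the octagon. -/
noncomputable def vertexPt (k : Fin 8) : O.region :=
  ⟨O.vertex k, (mem_frontier_iff.1 (vertex_mem_frontier k)).1⟩

/-- Distances to a frontier point do not depend on the sheets. Hence the planar shortcut through a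
frontier point contradicts additivity of distances at the vertex, even when the two outer points lie
on different sheets. -/
theorem not_isStrictlyBetween_vertex (s : Bool) (k : Fin 8) :
    ¬ IsStrictlyBetween (DoublyCovered.pt s (O.vertexPt k)) := by
  rintro ⟨a, b, ha, hb, hab⟩
  obtain ⟨s₁, p, rfl⟩ := DoublyCovered.exists_eq_pt a
  obtain ⟨s₂, q, rfl⟩ := DoublyCovered.exists_eq_pt b
  have hv : (O.vertexPt k : Plane) ∈ frontier O.region := vertex_mem_frontier k
  have hp : (p : Plane) ≠ O.vertex k := by
    intro h
    obtain rfl : p = O.vertexPt k := Subtype.ext h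
    exact ha (DoublyCovered.pt_eq_pt_of_frontier _ _ hv)
  have hq : (q : Plane) ≠ O.vertex k := by
    intro h
    obtain rfl : q = O.vertexPt k := Subtype.ext h
    exact hb (DoublyCovered.pt_eq_pt_of_frontier _ _ hv)
  obtain ⟨m, hm, hlt⟩ := exists_shortcut k p.2 q.2 hp hq
  set m' : O.region := ⟨m, (mem_frontier_iff.1 hm).1⟩
  have hm' : (m' : Plane) ∈ frontier O.region := hm
  have h1 : edist (DoublyCovered.pt s₁ p) (DoublyCovered.pt s₂ q) ≤ edist p m' + edist m' q := by
    refine (edist_triangle _ (DoublyCovered.pt s m') _).trans (add_le_add ?_ ?_)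
    · rw [DoublyCovered.edist_pt_of_frontier _ _ _ hm']
    · rw [edist_comm, DoublyCovered.edist_pt_of_frontier _ _ _ hm', edist_comm]
  rw [hab, DoublyCovered.edist_pt_of_frontier _ _ _ hv, edist_comm (DoublyCovered.pt s _),
    DoublyCovered.edist_pt_of_frontier _ _ _ hv, edist_comm q] at h1
  simp only [edist_dist] at h1
  rw [← ENNReal.ofReal_add dist_nonneg dist_nonneg, ← ENNReal.ofReal_add dist_nonneg dist_nonneg,
    ENNReal.ofReal_le_ofReal_iff (by positivity)] at h1
  exact absurd hlt (not_lt.2 h1)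

theorem exists_eq_vertexPt {s : Bool} {p : O.region}
    (h : ¬ IsStrictlyBetween (DoublyCovered.pt s p)) : ∃ k, p = O.vertexPt k := by
  by_contra hv
  push Not at hv
  obtain ⟨d, hd, h1, h2⟩ := exists_midpoint p.2 fun k hk => hv k (Subtype.ext hk)
  refine h ⟨DoublyCovered.pt s ⟨_, h1⟩, DoublyCovered.pt s ⟨_, h2⟩,
    DoublyCovered.pt_ne_pt fun h => ?_, DoublyCovered.pt_ne_pt fun h => ?_, ?_⟩
  · exact hd (by simpa using congrArg Subtype.val h)
  · exact hd (by simpa using congrArg Subtype.val h)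
  · rw [DoublyCovered.edist_pt, DoublyCovered.edist_pt, DoublyCovered.edist_pt]
    refine (mem_segment_edist (a := (p : Plane) + d) (b := p) (c := (p : Plane) - d) ?_).symm
    exact ⟨1 / 2, 1 / 2, by norm_num, by norm_num, by norm_num, by module⟩

/-- An isometry of doubly covered octagons maps vertices to vertices. -/
theorem exists_vertex_map {O O' : LatticeOctagon}
    (f : DoublyCovered O.region ≃ᵢ DoublyCovered O'.region) :
    ∃ σ : Fin 8 → Fin 8, ∀ k l,
      dist (O.vertex k) (O.vertex l) = dist (O'.vertex (σ k)) (O'.vertex (σ l)) := by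
  have hex : ∀ k, ∃ k' s, f (DoublyCovered.pt false (O.vertexPt k)) =
      DoublyCovered.pt s (O'.vertexPt k') := by
    intro k
    obtain ⟨s, p, hp⟩ := DoublyCovered.exists_eq_pt (f (DoublyCovered.pt false (O.vertexPt k)))
    have hn : ¬ IsStrictlyBetween (DoublyCovered.pt s p) := by
      rw [← hp]
      intro h
      have := h.map f.symm
      rw [f.symm_apply_apply] at this
      exact not_isStrictlyBetween_vertex _ _ this
    obtain ⟨k', rfl⟩ := exists_eq_vertexPt hn
    exact ⟨k', s, hp⟩
  choose σ s hσ using hex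
  refine ⟨σ, fun k l => ?_⟩
  have h := f.isometry.edist_eq (DoublyCovered.pt false (O.vertexPt k))
    (DoublyCovered.pt false (O.vertexPt l))
  rw [hσ, hσ, DoublyCovered.edist_pt,
    DoublyCovered.edist_pt_of_frontier _ _ _ (vertex_mem_frontier _), edist_dist, edist_dist,
    ENNReal.ofReal_eq_ofReal_iff dist_nonneg dist_nonneg] at h
  exact h.symm

theorem dist_sq_plane (p q : Plane) : dist p q ^ 2 = (p 0 - q 0) ^ 2 + (p 1 - q 1) ^ 2 := by
  rw [EuclideanSpace.dist_eq, Real.sq_sqrt (by positivity), Fin.sum_univ_two, Real.dist_eq,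
    Real.dist_eq, sq_abs, sq_abs]

/-- An octagon is determined by the distances between its labelled vertices. -/
theorem eq_of_vertex_dist {O O' : LatticeOctagon}
    (h : ∀ k l, dist (O.vertex k) (O.vertex l) = dist (O'.vertex k) (O'.vertex l)) : O = O' := by
  have hsq : ∀ k l, (O.vertex k 0 - O.vertex l 0) ^ 2 + (O.vertex k 1 - O.vertex l 1) ^ 2 =
      (O'.vertex k 0 - O'.vertex l 0) ^ 2 + (O'.vertex k 1 - O'.vertex l 1) ^ 2 := by
    intro k l
    rw [← dist_sq_plane, ← dist_sq_plane, h]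
  have root : ∀ {a b : ℝ}, 0 ≤ a → 0 ≤ b → a ^ 2 = b ^ 2 → a = b := fun ha hb hab =>
    (sq_eq_sq₀ ha hb).1 hab
  obtain ⟨r1, r2, r3, r4, r5, r6, r7, r8⟩ := O.real_bounds
  obtain ⟨t1, t2, t3, t4, t5, t6, t7, t8⟩ := O'.real_bounds
  -- The lengths of the four slanted edges give the cuts; the bottom and left edges then give width
  -- and height.
  have e1 : (O.bottomLeft : ℝ) = O'.bottomLeft := by
    have := hsq 0 7
    simp [vertex] at this
    exact root (by linarith) (by linarith) (by linarith)
  have e2 : (O.bottomRight : ℝ) = O'.bottomRight := by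
    have := hsq 1 2
    simp [vertex] at this
    exact root (by linarith) (by linarith) (by linarith)
  have e3 : (O.topRight : ℝ) = O'.topRight := by
    have := hsq 3 4
    simp [vertex] at this
    exact root (by linarith) (by linarith) (by linarith)
  have e4 : (O.topLeft : ℝ) = O'.topLeft := by
    have := hsq 5 6
    simp [vertex] at this
    exact root (by linarith) (by linarith) (by linarith)
  have e5 : (O.width : ℝ) = O'.width := by
    have := hsq 1 0
    simp only [vertex, Matrix.cons_val_zero, Matrix.cons_val_one] at this
    have := root (a := O.width - O.bottomRight - O.bottomLeft)
      (b := O'.width - O'.bottomRight - O'.bottomLeft) (by linarith) (by linarith) (by linarith)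
    linarith
  have e6 : (O.height : ℝ) = O'.height := by
    have := hsq 6 7
    simp only [vertex, Matrix.cons_val_zero, Matrix.cons_val_one] at this
    have := root (a := O.height - O.topLeft - O.bottomLeft)
      (b := O'.height - O'.topLeft - O'.bottomLeft) (by linarith) (by linarith) (by linarith)
    linarith
  cases O
  cases O'
  simp only [Nat.cast_inj] at e1 e2 e3 e4 e5 e6
  subst e1 e2 e3 e4 e5 e6
  rfl

/-! ### Counting isometry classes -/

/-- Octagons are equivalent if their doubles are isometric. -/
def isometricDoubles : Setoid LatticeOctagon where
  r O O' := Nonempty (DoublyCovered O.region ≃ᵢ DoublyCovered O'.region)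
  iseqv := ⟨fun _ => ⟨IsometryEquiv.refl _⟩, fun ⟨f⟩ => ⟨f.symm⟩, fun ⟨f⟩ ⟨g⟩ => ⟨f.trans g⟩⟩

/-- Each octagon in `F` induces a map of its vertex labels to those of `O₀`, and that map determines
all its vertex distances, hence the octagon. There are `8 ^ 8` maps. -/
theorem card_le_of_isometricDoubles (F : Finset LatticeOctagon) (O₀ : LatticeOctagon)
    (hF : ∀ O ∈ F, isometricDoubles O O₀) : F.card ≤ 8 ^ 8 := by
  classical
  have hex : ∀ O : LatticeOctagon, ∃ σ : Fin 8 → Fin 8, O ∈ F → ∀ k l,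
      dist (O.vertex k) (O.vertex l) = dist (O₀.vertex (σ k)) (O₀.vertex (σ l)) := by
    intro O
    by_cases hO : O ∈ F
    · obtain ⟨f⟩ := hF O hO
      obtain ⟨σ, hσ⟩ := exists_vertex_map f
      exact ⟨σ, fun _ => hσ⟩
    · exact ⟨id, fun h => absurd h hO⟩
  choose σ hσ using hex
  have h := Finset.card_le_card_of_injOn (s := F) (t := Finset.univ) σ (fun _ _ => Finset.mem_univ _)
    (fun O hO O' hO' h => eq_of_vertex_dist fun k l => by
      rw [hσ O hO, hσ O' hO', h])
  simpa using h

/-- A positive proportion of the octagons of a finite set have pairwise non-isometric doubles. -/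
theorem exists_transversal (F : Finset LatticeOctagon) : ∃ T ⊆ F, F.card ≤ 8 ^ 8 * T.card ∧
    ∀ O ∈ T, ∀ O' ∈ T, isometricDoubles O O' → O = O' := by
  classical
  let q : LatticeOctagon → Quotient isometricDoubles := Quotient.mk _
  obtain ⟨T, hTF, hT⟩ := Set.exists_subset_bijOn (F : Set LatticeOctagon) q
  have hfin : T.Finite := F.finite_toSet.subset hTF
  lift T to Finset LatticeOctagon using hfin
  refine ⟨T, by exact_mod_cast hTF, ?_, fun O hO O' hO' h => hT.injOn hO hO' (Quotient.sound h)⟩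
  have himg : F.image q = T.image q := by
    apply Finset.coe_injective
    rw [Finset.coe_image, Finset.coe_image, hT.image_eq]
  have h1 : F.card ≤ 8 ^ 8 * (F.image q).card := by
    refine Finset.card_le_mul_card_image F _ fun c _ => ?_
    obtain ⟨O₀, rfl⟩ := Quotient.exists_rep c
    exact card_le_of_isometricDoubles _ O₀ fun O hO => Quotient.exact (Finset.mem_filter.1 hO).2
  exact h1.trans (Nat.mul_le_mul_left _ (himg ▸ Finset.card_image_le))

/-- A six-parameter family of octagons. -/
def ofParams (k : ℕ) (x : Fin 6 → Fin k) : LatticeOctagon where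
  -- Every cut is at most `k`, so sides of length at least `2 * k + 1` leave room for any two cuts
  -- and all six parameters vary independently.
  width := 2 * k + 1 + x 4
  height := 2 * k + 1 + x 5
  bottomLeft := x 0 + 1
  bottomRight := x 1 + 1
  topRight := x 2 + 1
  topLeft := x 3 + 1
  bottomLeft_pos := by omega
  bottomRight_pos := by omega
  topRight_pos := by omega
  topLeft_pos := by omega
  bottom_lt := by omega
  top_lt := by omega
  left_lt := by omega
  right_lt := by omega

theorem ofParams_injective (k : ℕ) : Function.Injective (ofParams k) := by
  intro x y h
  simp only [ofParams, LatticeOctagon.mk.injEq] at h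
  obtain ⟨h4, h5, h0, h1, h2, h3⟩ := h
  ext l
  fin_cases l <;> simp <;> omega

theorem card_square_ofParams_le (k : ℕ) (x : Fin 6 → Fin k) :
    Nat.card (ofParams k x).Square ≤ 18 * k ^ 2 := by
  refine (card_square_le _).trans ?_
  have h4 : (ofParams k x).width ≤ 3 * k := by
    change 2 * k + 1 + (x 4 : ℕ) ≤ 3 * k
    omega
  have h5 : (ofParams k x).height ≤ 3 * k := by
    change 2 * k + 1 + (x 5 : ℕ) ≤ 3 * k
    omega
  calc 2 * ((ofParams k x).width * (ofParams k x).height) ≤ 2 * ((3 * k) * (3 * k)) := by gcongr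
    _ = 18 * k ^ 2 := by ring

theorem gluing_correspondsToConvexPolyhedron (O : LatticeOctagon) :
    O.gluing.CorrespondsToConvexPolyhedron :=
  Or.inr ⟨O.region, isConvexPolygon_region, O.nonempty_surface_isometryEquiv⟩

end LatticeOctagon

theorem theorem4 :
    ∃ c : ℝ, 0 < c ∧ ∃ N : ℕ, ∀ n : ℕ, N ≤ n →
      ∃ S : Finset (Σ m : ℕ, SquareGluing m),
        c * (n : ℝ) ^ 3 ≤ (S.card : ℝ) ∧
        (∀ G ∈ S, G.1 ≤ n ∧ G.2.CorrespondsToConvexPolyhedron ∧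
          ∃ O : LatticeOctagon, Nonempty (G.2.Surface ≃ᵢ DoublyCovered O.region)) ∧
        (∀ G ∈ S, ∀ H ∈ S, G ≠ H → IsEmpty (G.2.Surface ≃ᵢ H.2.Surface)) := by
  classical
  -- `18 * k ^ 2` bounds the number of squares, so `k` is the integer square root of `n / 18`, and
  -- `n ≥ 18` gives `k ≥ 1`. Rounding costs at most a factor `4`, as `(k + 1) ^ 2 ≤ 4 * k ^ 2`,
  -- whence `n ≤ 72 * k ^ 2`. Cubing this and combining it with the bound `k ^ 6 ≤ 8 ^ 8 * T.card`
  -- gives the constant.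
  refine ⟨1 / (8 ^ 8 * 72 ^ 3), by positivity, 18, fun n hn => ?_⟩
  set k := Nat.sqrt (n / 18) with hk
  have hk1 : 1 ≤ k := Nat.le_sqrt.2 (by omega)
  have hk2 : 18 * k ^ 2 ≤ n := by
    have : k * k ≤ n / 18 := Nat.sqrt_le (n / 18)
    rw [pow_two]; omega
  have hk3 : n ≤ 72 * k ^ 2 := by
    have h1 : n / 18 < (k + 1) * (k + 1) := Nat.lt_succ_sqrt (n / 18)
    have h2 : (k + 1) * (k + 1) ≤ 4 * k ^ 2 := by nlinarith
    omega
  obtain ⟨T, hTF, hcard, hT⟩ :=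
    LatticeOctagon.exists_transversal (Finset.univ.image (LatticeOctagon.ofParams k))
  rw [Finset.card_image_of_injective _ (LatticeOctagon.ofParams_injective k), Finset.card_univ,
    Fintype.card_fun, Fintype.card_fin, Fintype.card_fin] at hcard
  let g : LatticeOctagon → Σ m : ℕ, SquareGluing m := fun O => ⟨_, O.gluing⟩
  have hiso : ∀ O ∈ T, ∀ O' ∈ T, Nonempty ((g O).2.Surface ≃ᵢ (g O').2.Surface) → O = O' := by
    rintro O hO O' hO' ⟨f⟩
    obtain ⟨e⟩ := O.nonempty_surface_isometryEquiv
    obtain ⟨e'⟩ := O'.nonempty_surface_isometryEquiv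
    exact hT O hO O' hO' ⟨(e.symm.trans f).trans e'⟩
  have hinj : Set.InjOn g T := fun O hO O' hO' h =>
    hiso O hO O' hO' (h ▸ ⟨IsometryEquiv.refl _⟩)
  refine ⟨T.image g, ?_, ?_, ?_⟩
  · rw [Finset.card_image_of_injOn hinj]
    have h1 : (n : ℝ) ≤ 72 * (k : ℝ) ^ 2 := by exact_mod_cast hk3
    have h2 : (k : ℝ) ^ 6 ≤ 8 ^ 8 * (T.card : ℝ) := by exact_mod_cast hcard
    have h3 : (n : ℝ) ^ 3 ≤ (72 * (k : ℝ) ^ 2) ^ 3 := by gcongr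
    have h4 : (n : ℝ) ^ 3 ≤ 8 ^ 8 * 72 ^ 3 * T.card := by nlinarith
    rw [one_div, inv_mul_le_iff₀ (by positivity)]
    exact h4
  · intro G hG
    obtain ⟨O, hO, rfl⟩ := Finset.mem_image.1 hG
    obtain ⟨x, -, rfl⟩ := Finset.mem_image.1 (hTF hO)
    exact ⟨(LatticeOctagon.card_square_ofParams_le k x).trans hk2,
      LatticeOctagon.gluing_correspondsToConvexPolyhedron _,
      _, LatticeOctagon.nonempty_surface_isometryEquiv _⟩
  · intro G hG H hH hGH
    obtain ⟨O, hO, rfl⟩ := Finset.mem_image.1 hG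
    obtain ⟨O', hO', rfl⟩ := Finset.mem_image.1 hH
    by_contra hne
    rw [not_isEmpty_iff] at hne
    exact hGH (congrArg g (hiso O hO O' hO' hne))
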